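/- Model. For each $N$, consider $N$ identical parallel server pools, each able to hold at most $B\in\{0,1,2,\dots\}\cup\{\infty\}$ simultaneous tasks. Tasks arrive as a Poisson process of rate $\lambda(N)\ge 0$, where $\lambda(N)/N\to\lambda\in[0,\infty)$ as $N\to\infty$; each active task is completed after an independent exponential time with unit mean. Under the JSQ$(d(N))$ scheme ($1\le d(N)\le N$), an arriving task is directed to a server pool with the minimum number of active tasks among $d(N)$ server pools selected uniformly at random, either without or with replacement, ties being broken by an arbitrary (possibly randomized, configuration-dependent) rule; it is discarded if that pool already has $B$ active tasks. The ordinary JSQ policy directs each arriving task to a server pool with the minimum number of active tasks among all $N$ server pools. Let $Q_i^{\Pi}(t)$ be the number of server pools with $i$ or more active tasks at time $t$ in the $N$-th system under scheme $\Pi$. For every $N$ let an arbitrary initial law on the configurations with at most $B$ tasks per pool be given. For $g:\mathbb N\to\mathbb R$ with $g(N)\to\infty$, two schemes $\Pi_1,\Pi_2$ are called $g(N)$-alike if both families of systems can be constructed on a common probability space, each with its own law, starting for every $N$ from the same configuration distributed according to the given initial law, such that for all $T\ge 0$ and all $i\ge 1$ $$\sup_{t\in[0,T]}\frac{|Q_i^{\Pi_1}(t)-Q_i^{\Pi_2}(t)|}{g(N)}\longrightarrow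 0\quad\text{in probability as } N\to\infty .$$ Theorem. Let $g(N)\to\infty$. The JSQ policy and the JSQ$(d(N))$ scheme are $g(N)$-alike in each of the following cases: (i) $g(N)$ is of exact order $N$ (that is, $g(N)=O(N)$ and $N=O(g(N))$), and $d(N)\to\infty$; (ii) $g(N)=o(N)$, and $d(N)\left(\frac{N}{g(N)}\log\frac{N}{g(N)}\right)^{-1}\to\infty$. In particular, the JSQ$(d(N))$ scheme and the JSQ policy are $N$-alike if $d(N)\to\infty$, and they are $\sqrt N$-alike if $d(N)/(\sqrt N\log N)\to\infty$. -/

import Mathlib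

open MeasureTheory ProbabilityTheory Filter Topology Asymptotics
open scoped NNReal ENNReal

/-- A configuration of `N` server pools: `x n` is the number of active tasks at pool `n`. -/
abbrev Config (N : ℕ) : Type := Fin N → ℕ

/-- The occupancy `Q_i`: the number of server pools with `i` or more active tasks. -/
def occupancy {N : ℕ} (i : ℕ) (x : Config N) : ℕ :=
  (Finset.univ.filter fun n => i ≤ x n).card

/-- How the dispatcher draws the server pools that it inspects. -/
inductive Sampling where
  | withoutReplacement
  | withReplacement

/-- The probability that `S` is the set of server pools inspected, when `d` pools are drawn
uniformly at random from `N` pools. With replacement, the `d` draws form a uniformly distributed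
`d`-tuple and `S` is the set of its entries. -/
noncomputable def sampleProb (N d : ℕ) : Sampling → Finset (Fin N) → ℝ≥0
  | .withoutReplacement, S => if S.card = d then ((N.choose d : ℕ) : ℝ≥0)⁻¹ else 0
  | .withReplacement, S =>
      ((Finset.univ.filter fun v : Fin d → Fin N => Finset.univ.image v = S).card : ℝ≥0)
        / (N : ℝ≥0) ^ d

/-- A rule that breaks ties: `prob x S n` is the probability that a task is given to pool `n` when
the configuration is `x` and the inspected pools form the set `S`. The pool chosen always has the
minimum number of active tasks among those in `S`; otherwise the rule is arbitrary. -/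
structure TieRule (N : ℕ) where
  prob : Config N → Finset (Fin N) → Fin N → ℝ≥0
  sum_eq_one : ∀ x S, S.Nonempty → ∑ n, prob x S n = 1
  isMin : ∀ x S n, prob x S n ≠ 0 → n ∈ S ∧ ∀ m ∈ S, x n ≤ x m

/-- A task assignment scheme, parameterized by the number `N` of server pools: the probability that
a task which arrives when the configuration is `x` is directed to pool `n`. -/
abbrev Scheme : Type := ∀ N : ℕ, Config N → Fin N → ℝ≥0

/-- The JSQ(`d(N)`) scheme: draw `d N` server pools at random, and direct the task to one with the
minimum number of active tasks among them. -/
noncomputable def jsqd (m : Sampling) (tie : ∀ N, TieRule N) (d : ℕ → ℕ) : Scheme :=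
  fun N x n => ∑ S : Finset (Fin N), sampleProb N (d N) m S * (tie N).prob x S n

/-- The ordinary JSQ policy: all `N` server pools are inspected. -/
noncomputable def jsq (tie : ∀ N, TieRule N) : Scheme :=
  jsqd .withoutReplacement tie fun N => N

/-- The generator of the configuration process of `N` server pools with capacity `B`. Tasks arrive
at rate `lam` and go to pool `n` with probability `a x n`, being discarded if that pool already has
`B` tasks; every active task is completed at rate `1`. -/
noncomputable def generator {N : ℕ} (B : ℕ∞) (lam : ℝ≥0) (a : Config N → Fin N → ℝ≥0)
    (f : Config N → ℝ) (x : Config N) : ℝ :=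
  (∑ n, if (x n : ℕ∞) < B then
      (lam : ℝ) * a x n * (f (Function.update x n (x n + 1)) - f x) else 0)
    + ∑ n, (x n : ℝ) * (f (Function.update x n (x n - 1)) - f x)

/-- `X` is a (non-explosive) continuous-time Markov chain with initial law `μ₀` and the generator
above. It has càdlàg paths in the discrete space of configurations (hence finitely many jumps in
bounded time intervals) and solves the martingale problem of the generator on the functions with
finite support; since the jump rates are bounded on finite sets, this determines its law. -/
structure IsSystem {N : ℕ} (B : ℕ∞) (lam : ℝ≥0) (a : Config N → Fin N → ℝ≥0)
    (μ₀ : Measure (Config N)) {Ω : Type*} [mΩ : MeasurableSpace Ω] (P : Measure Ω)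
    (X : ℝ≥0 → Ω → Config N) : Prop where
  measurable : ∀ t, Measurable (X t)
  cadlag : ∀ᵐ ω ∂P, ∀ t, (∀ᶠ s in 𝓝[>] t, X s ω = X t ω) ∧ ∃ y, ∀ᶠ s in 𝓝[<] t, X s ω = y
  initial : P.map (X 0) = μ₀
  martingale : ∃ ℱ : Filtration ℝ≥0 mΩ, (∀ t, Measurable[ℱ t] (X t)) ∧
    ∀ f : Config N → ℝ, f.support.Finite →
      Martingale (fun (t : ℝ≥0) ω =>
        f (X t ω) - ∫ s in (0 : ℝ)..t, generator B lam a f (X s.toNNReal ω)) ℱ P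

/-- Two schemes are `g(N)`-alike, for server pools of capacity `B`, arrival rates `lam N` and
initial laws `μ N`: on a common probability space there are, for every `N`, versions `X N` and `Y N`
of the two systems that start from the same configuration, such that for all `T` and all `i ≥ 1`,
`sup_{t ≤ T} |Q_i^X(t) - Q_i^Y(t)| / g(N) → 0` in probability as `N → ∞`. -/
def Alike (B : ℕ∞) (lam : ℕ → ℝ≥0) (μ : ∀ N, Measure (Config N)) (g : ℕ → ℝ)
    (a₁ a₂ : Scheme) : Prop :=
  ∃ (Ω : Type) (_ : MeasurableSpace Ω) (P : Measure Ω) (_ : IsProbabilityMeasure P)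
    (X Y : ∀ N, ℝ≥0 → Ω → Config N),
    (∀ N, IsSystem B (lam N) (a₁ N) (μ N) P (X N)) ∧
    (∀ N, IsSystem B (lam N) (a₂ N) (μ N) P (Y N)) ∧
    (∀ N, ∀ᵐ ω ∂P, X N 0 ω = Y N 0 ω) ∧
    ∀ (T : ℝ≥0) (i : ℕ), 1 ≤ i →
      TendstoInMeasure P
        (fun N ω => ⨆ t : Set.Icc (0 : ℝ≥0) T,
          |(occupancy i (X N t ω) : ℝ) - (occupancy i (Y N t ω) : ℝ)| / g N)
        atTop (fun _ => (0 : ℝ))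

/-! ### The exponential distribution -/

/-! Write x for the configuration under JSQ and y for the one under JSQ(d), and let `load k` be the
sum Q_1 + ... + Q_k. The two systems are coupled as follows. Arrivals are common to both. Tasks are
sorted by the occupancy of their pools, and tasks at equal positions of the two lists finish
together. Call an arrival a failure if JSQ(d) sends it to a pool with at least r pools strictly
below it, and let e count the failures. The invariant `MoreBalanced` is load k y ≤ load k x ≤ load k
y + k r + e for all k.

Departures preserve it because `load k` drops exactly when the position of the finished task is
below (k+1) `load k` - k `load (k+1)`. When either inequality is tight at k, its instance at k+1
orders these thresholds the right way (`MoreBalanced.depart`). Arrivals preserve it because JSQ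
raises `load k` whenever this is possible, while a non-failing arrival that cannot raise `load k y`
shows that all but fewer than r pools of y are already at height k or full (`MoreBalanced.arrive`).
Differencing in k gives |Q_i(x) - Q_i(y)| ≤ i r + e.

A failure requires the sample to miss some set of r pools, which has probability at most exp(-d r /
N) under either kind of sampling (`sum_jsqd_poolsBelow_le`). Thus the mean number of failures up to
T is at most lam T exp(-d r / N), and Markov's inequality leaves two requirements: r = o(g) and lam
exp(-d r / N) = o(g) (`alike_of_tendsto`). The choice r = ⌈g / √w⌉ with a suitable w → ∞ meets both
in each regime.

The coupled chain must also be shown to exist and to solve the martingale problems of its marginals.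
It is built from independent exponential clocks and sampled destinations. Over one jump, the jump
term and its compensator have equal means (`integral_noiseLaw_jump`); summing over jumps gives
Dynkin's martingale (`martingale_dynkinProcess`), and at most linear growth of the rates excludes
explosion (`isNonexplosive`). -/

lemma integral_expMeasure_one (h : ℝ → ℝ) :
    ∫ v, h v ∂(expMeasure 1) = ∫ v in Set.Ioi 0, Real.exp (-v) * h v := by
  have hm : Measurable (gammaPDF 1 1) := (measurable_gammaPDFReal 1 1).ennreal_ofReal
  rw [expMeasure, gammaMeasure, integral_withDensity_eq_integral_toReal_smul hm
    (ae_of_all _ fun x => by simp [gammaPDF]), ← integral_indicator measurableSet_Ioi]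
  refine integral_congr_ae ?_
  filter_upwards [(volume : Measure ℝ).ae_ne 0] with v hv
  rcases lt_or_gt_of_ne hv with hv | hv
  · simp [gammaPDF_of_neg hv, hv.le]
  · have : gammaPDF 1 1 v = exponentialPDF 1 v := rfl
    simp [this, exponentialPDF_of_nonneg hv.le, hv, ENNReal.toReal_ofReal (Real.exp_pos _).le]

lemma ae_pos_expMeasure_one : ∀ᵐ v ∂(expMeasure 1), 0 < v := by
  have hm : Measurable (gammaPDF 1 1) := (measurable_gammaPDFReal 1 1).ennreal_ofReal
  rw [expMeasure, gammaMeasure, ae_withDensity_iff hm]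
  filter_upwards [(volume : Measure ℝ).ae_ne 0] with v hv h0
  rcases lt_or_gt_of_ne hv with hv | hv
  · exact absurd (gammaPDF_of_neg hv) h0
  · exact hv

lemma integral_expMeasure_indicator_Ioi {a : ℝ} (ha : 0 ≤ a) :
    ∫ v, (Set.Ioi a).indicator 1 v ∂(expMeasure 1) = Real.exp (-a) := by
  rw [integral_expMeasure_one, ← integral_exp_neg_Ioi, ← integral_indicator measurableSet_Ioi,
    ← integral_indicator measurableSet_Ioi]
  congr 1
  ext v
  by_cases hv : a < v
  · simp [hv, ha.trans_lt hv]
  · simp [hv]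

lemma integral_expMeasure_sub_posPart {a : ℝ} (ha : 0 ≤ a) :
    ∫ v, max (v - a) 0 ∂(expMeasure 1) = Real.exp (-a) := by
  -- Explicit antiderivative of (v - a) exp(-v), chosen to vanish at infinity.
  have hd : ∀ v ∈ Set.Ici a, HasDerivAt (fun v => -((v - a + 1) * Real.exp (-v)))
      (Real.exp (-v) * max (v - a) 0) v := by
    intro v hv
    have h1 : HasDerivAt (fun v => v - a + 1) 1 v := ((hasDerivAt_id v).sub_const a).add_const 1
    have h2 : HasDerivAt (fun v => Real.exp (-v)) (Real.exp (-v) * (-1)) v :=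
      (hasDerivAt_neg v).exp
    rw [max_eq_left (sub_nonneg.2 hv)]
    convert! (h1.mul h2).neg using 1
    ring
  have hlim : Tendsto (fun v => -((v - a + 1) * Real.exp (-v))) atTop (𝓝 0) := by
    have h1 := Real.tendsto_pow_mul_exp_neg_atTop_nhds_zero 1
    have h2 := Real.tendsto_pow_mul_exp_neg_atTop_nhds_zero 0
    have h3 := (h1.add (h2.const_mul (1 - a))).neg
    simp only [mul_zero, add_zero, neg_zero] at h3
    refine h3.congr fun v => ?_
    ring
  have h0 : ∀ v ∈ Set.Ioi a, 0 ≤ Real.exp (-v) * max (v - a) 0 := fun v _ => by positivity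
  have h := integral_Ioi_of_hasDerivAt_of_nonneg' hd h0 hlim
  rw [integral_expMeasure_one]
  have : ∫ v in Set.Ioi 0, Real.exp (-v) * max (v - a) 0
      = ∫ v in Set.Ioi a, Real.exp (-v) * max (v - a) 0 := by
    rw [← integral_indicator measurableSet_Ioi, ← integral_indicator measurableSet_Ioi]
    congr 1
    ext v
    by_cases hv : a < v
    · simp [hv, ha.trans_lt hv]
    · simp [hv, not_lt.1 hv]
  rw [this, h]
  simp

/-- A non-integrable function has Bochner integral 0 by convention, whereas this integral is exp(-a)
> 0. -/
lemma integrable_expMeasure_sub_posPart {a : ℝ} (ha : 0 ≤ a) :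
    Integrable (fun v => max (v - a) 0) (expMeasure 1) := by
  by_contra h
  have := integral_expMeasure_sub_posPart ha
  rw [integral_undef h] at this
  exact (Real.exp_pos _).ne this

/-- The probability that an exponential clock of rate `q`, started at time `τ`, rings in `(s, t]`
is `q` times the expected length of the part of `(s, t]` during which it has been running. -/
lemma integral_exponential_clock {q : ℝ} (hq : 0 < q) {s t : ℝ} (hst : s ≤ t) (τ : ℝ) :
    ∫ v, (Set.Ioc s t).indicator (1 : ℝ → ℝ) (τ + |v| / q) ∂(expMeasure 1)
      = q * ∫ v, (max s (min (τ + |v| / q) t) - max s (min τ t)) ∂(expMeasure 1) := by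
  have := isProbabilityMeasure_expMeasure one_pos
  -- In the variable v, the clock rings after s iff v > a, and after t iff v > b. Both sides then
  -- equal exp(-a) - exp(-b).
  set a := max 0 (q * (s - τ))
  set b := max 0 (q * (t - τ))
  have ha : 0 ≤ a := le_max_left _ _
  have hb : 0 ≤ b := le_max_left _ _
  have hab : a ≤ b := max_le_max le_rfl (by gcongr)
  have h1 : ∫ v, (Set.Ioc s t).indicator (1 : ℝ → ℝ) (τ + |v| / q) ∂(expMeasure 1)
      = ∫ v, ((Set.Ioi a).indicator 1 v - (Set.Ioi b).indicator 1 v) ∂(expMeasure 1) := by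
    refine integral_congr_ae ?_
    filter_upwards [ae_pos_expMeasure_one] with v hv
    have e1 : s < τ + |v| / q ↔ a < v := by
      rw [abs_of_pos hv, ← sub_lt_iff_lt_add', lt_div_iff₀ hq, max_lt_iff, mul_comm]
      simp [hv]
    have e2 : τ + |v| / q ≤ t ↔ ¬ b < v := by
      rw [abs_of_pos hv, ← le_sub_iff_add_le', div_le_iff₀ hq, not_lt, le_max_iff, mul_comm]
      simp [hv]
    simp only [Set.indicator_apply, Set.mem_Ioc, Set.mem_Ioi, e1, e2, Pi.one_apply]
    by_cases h1 : a < v <;> by_cases h2 : b < v <;> simp [h1, h2]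
    exact absurd (hab.trans_lt h2) h1
  have h2 : q * ∫ v, (max s (min (τ + |v| / q) t) - max s (min τ t)) ∂(expMeasure 1)
      = ∫ v, (max (v - a) 0 - max (v - b) 0) ∂(expMeasure 1) := by
    rw [← integral_const_mul]
    refine integral_congr_ae ?_
    filter_upwards [ae_pos_expMeasure_one] with v hv
    rw [abs_of_pos hv]
    have hw : 0 < v / q := div_pos hv hq
    have ev : v = q * (v / q) := by field_simp
    have ea : max (v - a) 0 = q * max (v / q - max 0 (s - τ)) 0 := by
      rw [mul_max_of_nonneg _ _ hq.le, mul_sub, mul_max_of_nonneg _ _ hq.le, ← ev]; simp [a]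
    have eb : max (v - b) 0 = q * max (v / q - max 0 (t - τ)) 0 := by
      rw [mul_max_of_nonneg _ _ hq.le, mul_sub, mul_max_of_nonneg _ _ hq.le, ← ev]; simp [b]
    simp only [ea, eb, ← mul_sub]
    congr 1
    generalize v / q = w at hw
    simp only [max_def, min_def]
    split_ifs <;> linarith
  rw [h1, h2, integral_sub, integral_sub, integral_expMeasure_indicator_Ioi ha,
    integral_expMeasure_indicator_Ioi hb, integral_expMeasure_sub_posPart ha,
    integral_expMeasure_sub_posPart hb]
  · exact integrable_expMeasure_sub_posPart ha
  · exact integrable_expMeasure_sub_posPart hb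
  · exact (integrable_const (1 : ℝ)).indicator measurableSet_Ioi
  · exact (integrable_const (1 : ℝ)).indicator measurableSet_Ioi

/-! ### Piecewise constant paths -/

/-- For a sequence `T` of jump times, the number of jumps up to time `t`. -/
noncomputable def jumpIndex (T : ℕ → ℝ) (t : ℝ) : ℕ := sInf {k | t < T (k + 1)}

section Path

variable {T : ℕ → ℝ} {s t : ℝ}

/-- The hypothesis `∃ k, t < T k` excludes an explosion before t, in which case `sInf ∅ = 0` would
give a meaningless index. -/
lemma lt_jumpIndex_iff (hT : Monotone T) (ht : ∃ k, t < T k) {k : ℕ} :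
    k < jumpIndex T t ↔ T (k + 1) ≤ t := by
  obtain ⟨j, hj⟩ := ht
  have hne : {k | t < T (k + 1)}.Nonempty := ⟨j, hj.trans_le (hT j.le_succ)⟩
  refine ⟨fun h => not_lt.1 fun h' => (Nat.sInf_le h').not_gt h, fun h => ?_⟩
  by_contra hk
  have := hT (Nat.succ_le_succ (not_lt.1 hk))
  exact (Nat.sInf_mem hne).not_ge (this.trans h)

lemma le_jumpIndex_iff_of_pos (hT : Monotone T) (ht : ∃ k, t < T k) {k : ℕ} (hk : 0 < k) :
    k ≤ jumpIndex T t ↔ T k ≤ t := by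
  obtain ⟨j, rfl⟩ := Nat.exists_eq_succ_of_ne_zero hk.ne'
  exact lt_jumpIndex_iff hT ht

lemma jumpIndex_eq (hT : Monotone T) {k : ℕ} (h1 : T k ≤ t) (h2 : t < T (k + 1)) :
    jumpIndex T t = k := by
  refine le_antisymm (Nat.sInf_le h2) (not_lt.1 fun h => ?_)
  have hne : {k | t < T (k + 1)}.Nonempty := ⟨k, h2⟩
  have h3 : t < T (jumpIndex T t + 1) := Nat.sInf_mem hne
  exact (h3.trans_le (hT h)).not_ge h1

lemma jumpIndex_mono (hT : Monotone T) (hst : s ≤ t) (ht : ∃ k, t < T k) :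
    jumpIndex T s ≤ jumpIndex T t := by
  refine not_lt.1 fun h => ?_
  have hs : ∃ k, s < T k := ht.imp fun k => hst.trans_lt
  exact lt_irrefl _ ((lt_jumpIndex_iff hT ht).2 (((lt_jumpIndex_iff hT hs).1 h).trans hst))

lemma jumpIndex_lt (hT : Monotone T) (h0 : T 0 ≤ t) {K : ℕ} (hK : t < T K) :
    jumpIndex T t < K := by
  obtain rfl | hK0 := Nat.eq_zero_or_pos K
  · exact absurd hK h0.not_gt
  · exact not_le.1 fun h => hK.not_ge ((le_jumpIndex_iff_of_pos hT ⟨K, hK⟩ hK0).1 h)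

lemma eventually_jumpIndex_right (hT : Monotone T) (h0 : T 0 ≤ t) (ht : ∃ k, t < T k) :
    ∀ᶠ v in 𝓝[>] t, jumpIndex T v = jumpIndex T t := by
  have h1 : T (jumpIndex T t) ≤ t := by
    obtain h | h := Nat.eq_zero_or_pos (jumpIndex T t)
    · rwa [h]
    · exact (le_jumpIndex_iff_of_pos hT ht h).1 le_rfl
  have h2 : t < T (jumpIndex T t + 1) :=
    not_le.1 fun h => lt_irrefl _ ((lt_jumpIndex_iff hT ht).2 h)
  filter_upwards [Ioo_mem_nhdsGT h2] with v hv
  exact jumpIndex_eq hT (h1.trans hv.1.le) hv.2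

lemma exists_eventually_jumpIndex_left (hT : Monotone T) (h0 : T 0 < t) (ht : ∃ k, t < T k) :
    ∃ j, ∀ᶠ v in 𝓝[<] t, jumpIndex T v = j := by
  obtain ⟨k, hk⟩ := ht
  -- The left limit has the index of the last jump strictly before t, hence `≤` here in place of the
  -- `<` in `jumpIndex`.
  have hne : ∃ k, t ≤ T (k + 1) := ⟨k, hk.le.trans (hT k.le_succ)⟩
  classical
  have h2 := Nat.find_spec hne
  have h1 : T (Nat.find hne) < t := by
    obtain h | h := Nat.eq_zero_or_pos (Nat.find hne)
    · rwa [h]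
    · have := Nat.find_min hne (Nat.sub_lt h one_pos)
      rwa [Nat.sub_add_cancel (show 1 ≤ _ from h), not_le] at this
  refine ⟨Nat.find hne, ?_⟩
  filter_upwards [Ioo_mem_nhdsLT h1] with v hv
  exact jumpIndex_eq hT hv.1.le (hv.2.trans_le h2)

lemma sum_range_ite_sub (y : ℕ → ℝ) {a b : ℕ} (hab : a ≤ b) (K : ℕ) :
    ∑ k ∈ Finset.range K, (if a ≤ k ∧ k < b then y (k + 1) - y k else 0)
      = y (max a (min b K)) - y a := by
  induction K with
  | zero => simp
  | succ K ih =>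
    rw [Finset.sum_range_succ, ih]
    by_cases h : a ≤ K ∧ K < b
    · rw [if_pos h, show max a (min b K) = K by omega, show max a (min b (K + 1)) = K + 1 by omega]
      ring
    · rw [if_neg h, show max a (min b (K + 1)) = max a (min b K) by omega, add_zero]

/-- The jumps in (s, t] are those with index between `jumpIndex T s` and `jumpIndex T t`, so the sum
telescopes. Truncation at an arbitrary K is kept because it yields bounds uniform in K. -/
lemma sum_range_indicator_sub (hT : Monotone T) (hst : s ≤ t) (ht : ∃ k, t < T k)
    (y : ℕ → ℝ) (K : ℕ) :
    ∑ k ∈ Finset.range K, (Set.Ioc s t).indicator (1 : ℝ → ℝ) (T (k + 1)) * (y (k + 1) - y k)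
      = y (max (jumpIndex T s) (min (jumpIndex T t) K)) - y (jumpIndex T s) := by
  have hs : ∃ k, s < T k := ht.imp fun k => hst.trans_lt
  rw [← sum_range_ite_sub y (jumpIndex_mono hT hst ht)]
  refine Finset.sum_congr rfl fun k _ => ?_
  simp only [lt_jumpIndex_iff hT ht, ← not_lt, Set.indicator_apply, Set.mem_Ioc,
    (lt_jumpIndex_iff hT hs), Pi.one_apply]
  simp only [not_lt, not_le]
  split_ifs <;> simp

lemma sum_range_indicator_sub_of_lt (hT : Monotone T) (h0 : T 0 ≤ t) (hst : s ≤ t) {K : ℕ}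
    (hK : t < T K) (y : ℕ → ℝ) :
    ∑ k ∈ Finset.range K, (Set.Ioc s t).indicator (1 : ℝ → ℝ) (T (k + 1)) * (y (k + 1) - y k)
      = y (jumpIndex T t) - y (jumpIndex T s) := by
  rw [sum_range_indicator_sub hT hst ⟨K, hK⟩, min_eq_left (jumpIndex_lt hT h0 hK).le,
    max_eq_right (jumpIndex_mono hT hst ⟨K, hK⟩)]

lemma integral_jumpIndex (hT : Monotone T) (h0 : T 0 ≤ s) (hst : s ≤ t) {K : ℕ}
    (hK : t < T K) (y : ℕ → ℝ) :
    IntervalIntegrable (fun v => y (jumpIndex T v)) volume s t ∧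
    ∫ v in s..t, y (jumpIndex T v)
      = ∑ k ∈ Finset.range K, y k * (max s (min (T (k + 1)) t) - max s (min (T k) t)) := by
  -- The interval is cut at the jump times clamped to [s, t]; pieces outside it become degenerate.
  set c : ℕ → ℝ := fun k => max s (min (T k) t) with hc
  have hcm : Monotone c := fun i j hij => max_le_max le_rfl (min_le_min (hT hij) le_rfl)
  have hc0 : c 0 = s := max_eq_left ((min_le_left _ _).trans h0)
  have hcK : c K = t := by simp [hc, hK.le, hst]
  have key : ∀ k, ∀ᵐ v, v ∈ Set.uIoc (c k) (c (k + 1)) → y (jumpIndex T v) = y k := by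
    intro k
    filter_upwards [(volume : Measure ℝ).ae_ne (c (k + 1))] with v hv hmem
    rw [Set.uIoc_of_le (hcm k.le_succ)] at hmem
    have hlt : v < c (k + 1) := lt_of_le_of_ne hmem.2 hv
    have hs : s < v := (le_max_left _ _).trans_lt hmem.1
    have h1 : v < min (T (k + 1)) t := (lt_max_iff.1 hlt).resolve_left hs.not_gt
    have h2 : min (T k) t < v := (le_max_right _ _).trans_lt hmem.1
    have h3 : T k < v := (min_lt_iff.1 h2).resolve_right (h1.trans_le (min_le_right _ _)).not_gt
    rw [jumpIndex_eq hT h3.le (h1.trans_le (min_le_left _ _))]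
  have hint : ∀ k, IntervalIntegrable (fun v => y (jumpIndex T v)) volume (c k) (c (k + 1)) := by
    intro k
    refine (intervalIntegrable_const (c := y k)).congr_ae ?_
    rw [Filter.EventuallyEq, ae_restrict_iff' measurableSet_uIoc]
    filter_upwards [key k] with v hv hm using (hv hm).symm
  constructor
  · have := IntervalIntegrable.trans_iterate (a := c) (n := K) fun k _ => hint k
    rwa [hc0, hcK] at this
  · have := intervalIntegral.sum_integral_adjacent_intervals (a := c) (n := K) fun k _ => hint k
    rw [hc0, hcK] at this
    rw [← this]
    refine Finset.sum_congr rfl fun k _ => ?_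
    rw [intervalIntegral.integral_congr_ae (key k), intervalIntegral.integral_const, smul_eq_mul,
      mul_comm]

end Path

/-! ### Jump chains -/

section JumpChain

variable {E : Type*} [MeasurableSpace E]

/-- The total jump rate out of the state `z`, if the jumps from `z` to states in `A` have rate
`R z A`. -/
noncomputable def totalRate (R : E → Measure E) (z : E) : ℝ := (R z).real Set.univ

/-- The law of the state after a jump out of the state `z`. -/
noncomputable def jumpLaw (R : E → Measure E) (z : E) : Measure E := (R z Set.univ)⁻¹ • R z

/-- The law of the randomness used in one jump: an exponential clock, and an independent sample of
the jump law at every state. -/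
noncomputable def noiseLaw (R : E → Measure E) : Measure (ℝ × (E → E)) :=
  (expMeasure 1).prod (Measure.infinitePi (jumpLaw R))

/-- The infinitesimal generator of the jump process with rates `R`. -/
noncomputable def jumpGenerator (R : E → Measure E) (f : E → ℝ) (z : E) : ℝ :=
  ∫ z', (f z' - f z) ∂(R z)

/-- The states visited by the jump process and the times of its jumps, as a function of the initial
state and the noise. -/
noncomputable def jumpChain (R : E → Measure E) (z₀ : E) (ξ : ℕ → ℝ × (E → E)) : ℕ → E × ℝ
  | 0 => (z₀, 0)
  | k + 1 => ((ξ k).2 (jumpChain R z₀ ξ k).1,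
      (jumpChain R z₀ ξ k).2 + |(ξ k).1| / totalRate R (jumpChain R z₀ ξ k).1)

/-- Jump rates which are finite and do not vanish. -/
class IsJumpRate (R : E → Measure E) : Prop where
  isFinite : ∀ z, IsFiniteMeasure (R z)
  ne_zero : ∀ z, R z ≠ 0

variable (R : E → Measure E) [IsJumpRate R]

instance IsJumpRate.isFiniteMeasure (z : E) : IsFiniteMeasure (R z) := IsJumpRate.isFinite z

instance IsJumpRate.neZero (z : E) : NeZero (R z) := ⟨IsJumpRate.ne_zero z⟩

instance (z : E) : IsProbabilityMeasure (jumpLaw R z) := by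
  unfold jumpLaw; infer_instance

instance : IsProbabilityMeasure (noiseLaw R) := by
  have := isProbabilityMeasure_expMeasure one_pos
  unfold noiseLaw; infer_instance

lemma totalRate_pos (z : E) : 0 < totalRate R z := by
  refine ENNReal.toReal_pos ?_ (measure_ne_top _ _)
  simpa using IsJumpRate.ne_zero (R := R) z

/-- The absolute value of the clock in `jumpChain` makes this hold for every noise, not only almost
surely. -/
lemma monotone_jumpChain_snd (z₀ : E) (ξ : ℕ → ℝ × (E → E)) :
    Monotone fun k => (jumpChain R z₀ ξ k).2 :=
  monotone_nat_of_le_succ fun _ =>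
    le_add_of_nonneg_right (div_nonneg (abs_nonneg _) (totalRate_pos R _).le)

omit [IsJumpRate R] in
lemma integral_jumpLaw (f : E → ℝ) (z : E) :
    ∫ z', f z' ∂(jumpLaw R z) = (totalRate R z)⁻¹ * ∫ z', f z' ∂(R z) := by
  rw [jumpLaw, integral_smul_measure]
  simp [totalRate, Measure.real, ENNReal.toReal_inv]

/-- Dynkin's formula over a single jump. Clock and destination are independent, so the mean of the
first term is a product: `integral_exponential_clock` gives the total rate times the mean running
time in (s, t], and the destination gives the generator divided by the total rate. -/
lemma integral_noiseLaw_jump {f : E → ℝ} (hf : Measurable f) {C : ℝ} (hC : ∀ z, |f z| ≤ C)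
    {s t : ℝ} (hst : s ≤ t) (z : E) (τ : ℝ) :
    ∫ x, ((Set.Ioc s t).indicator (1 : ℝ → ℝ) (τ + |x.1| / totalRate R z) * (f (x.2 z) - f z)
      - jumpGenerator R f z * (max s (min (τ + |x.1| / totalRate R z) t) - max s (min τ t)))
      ∂(noiseLaw R) = 0 := by
  have := isProbabilityMeasure_expMeasure one_pos
  have hq := totalRate_pos R z
  have hmap : ∫ w, (f (w z) - f z) ∂(Measure.infinitePi (jumpLaw R))
      = (totalRate R z)⁻¹ * jumpGenerator R f z := by
    rw [jumpGenerator, ← integral_jumpLaw, ← Measure.infinitePi_map_eval (jumpLaw R) z,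
      integral_map (measurable_pi_apply z).aemeasurable
        (hf.sub_const _).stronglyMeasurable.aestronglyMeasurable]
  have hi : Measurable fun v : ℝ => (Set.Ioc s t).indicator (1 : ℝ → ℝ) (τ + |v| / totalRate R z) :=
    (measurable_one.indicator measurableSet_Ioc).comp (by fun_prop)
  rw [integral_sub, noiseLaw, integral_prod_mul
    (fun v => (Set.Ioc s t).indicator (1 : ℝ → ℝ) (τ + |v| / totalRate R z))
    (fun w : E → E => f (w z) - f z), hmap, integral_const_mul,
    integral_exponential_clock hq hst τ]
  · have := integral_prod_mul (μ := expMeasure 1) (ν := Measure.infinitePi (jumpLaw R))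
      (fun v => max s (min (τ + |v| / totalRate R z) t) - max s (min τ t)) (fun _ => (1 : ℝ))
    simp only [mul_one, integral_const, probReal_univ, smul_eq_mul] at this
    rw [this]
    field_simp
    ring
  · refine Integrable.of_bound (C := 1 * (C + C)) ?_ (ae_of_all _ fun x => ?_)
    · refine Measurable.aestronglyMeasurable ?_
      exact (hi.comp measurable_fst).mul
        ((hf.comp ((measurable_pi_apply z).comp measurable_snd)).sub_const _)
    · rw [norm_mul]
      refine mul_le_mul ?_ ?_ (norm_nonneg _) zero_le_one
      · refine (norm_indicator_le_norm_self _ _).trans (by simp)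
      · exact (norm_sub_le _ _).trans (add_le_add (hC _) (hC _))
  · refine Integrable.const_mul ?_ _
    refine Integrable.of_bound (C := t - s) (by fun_prop) (ae_of_all _ fun x => ?_)
    rw [Real.norm_eq_abs, abs_sub_le_iff]
    have h (a : ℝ) : s ≤ max s (min a t) ∧ max s (min a t) ≤ t :=
      ⟨le_max_left _ _, max_le hst (min_le_right _ _)⟩
    have h1 := h (τ + |x.1| / totalRate R z)
    have h2 := h τ
    constructor <;> linarith [h1.1, h1.2, h2.1, h2.2]

end JumpChain

/-! ### Construction of the jump process and its filtration -/

section JumpProcess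

variable {E : Type*} [MeasurableSpace E] {Ω : Type*} {mΩ : MeasurableSpace Ω}

/-- `Z₀` is an initial state and `ξ` is a sequence of independent noises with the law that drives
the jump process with rates `R`; the σ-algebra `G k` contains the information that is available
after `k` jumps. -/
structure IsJumpNoise (R : E → Measure E) (P : Measure Ω) (G : Filtration ℕ mΩ) (Z₀ : Ω → E)
    (ξ : ℕ → Ω → ℝ × (E → E)) : Prop where
  initial : Measurable[G 0] Z₀
  noise : ∀ k, Measurable[G (k + 1)] (ξ k)
  indep : ∀ k, Indep (G k) (MeasurableSpace.comap (ξ k) inferInstance) P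
  law : ∀ k, P.map (ξ k) = noiseLaw R

variable (R : E → Measure E) (Z₀ : Ω → E) (ξ : ℕ → Ω → ℝ × (E → E))

/-- The state after `k` jumps. -/
noncomputable def jumpState (k : ℕ) (ω : Ω) : E := (jumpChain R (Z₀ ω) (fun j => ξ j ω) k).1

/-- The time of the `k`-th jump. -/
noncomputable def jumpTime (k : ℕ) (ω : Ω) : ℝ := (jumpChain R (Z₀ ω) (fun j => ξ j ω) k).2

/-- The jump process with rates `R`. -/
noncomputable def jumpProcess (t : ℝ≥0) (ω : Ω) : E :=
  jumpState R Z₀ ξ (jumpIndex (fun k => jumpTime R Z₀ ξ k ω) t) ω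

/-- Only finitely many jumps occur in bounded time intervals. -/
def IsNonexplosive (P : Measure Ω) : Prop :=
  ∀ᵐ ω ∂P, ∀ t : ℝ, ∃ k, t < jumpTime R Z₀ ξ k ω

variable {R Z₀ ξ}

@[simp] lemma jumpState_zero (ω : Ω) : jumpState R Z₀ ξ 0 ω = Z₀ ω := rfl

@[simp] lemma jumpTime_zero (ω : Ω) : jumpTime R Z₀ ξ 0 ω = 0 := rfl

lemma jumpTime_succ (k : ℕ) (ω : Ω) : jumpTime R Z₀ ξ (k + 1) ω
    = jumpTime R Z₀ ξ k ω + |(ξ k ω).1| / totalRate R (jumpState R Z₀ ξ k ω) := rfl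

lemma monotone_jumpTime [IsJumpRate R] (ω : Ω) : Monotone fun k => jumpTime R Z₀ ξ k ω :=
  monotone_jumpChain_snd R _ _

lemma jumpProcess_zero_of_pos [IsJumpRate R] {ω : Ω} (h : 0 < jumpTime R Z₀ ξ 1 ω) :
    jumpProcess R Z₀ ξ 0 ω = Z₀ ω := by
  rw [jumpProcess, jumpIndex_eq (monotone_jumpTime ω) (k := 0) (by simp) (by simpa using h)]
  rfl

variable [Countable E] [MeasurableSingletonClass E] [IsJumpRate R] {P : Measure Ω}
  {G : Filtration ℕ mΩ}

namespace IsJumpNoise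

variable (hξ : IsJumpNoise R P G Z₀ ξ)
include hξ

omit [IsJumpRate R] in
lemma measurable_jumpChain (k : ℕ) :
    Measurable[G k] fun ω => (jumpState R Z₀ ξ k ω, jumpTime R Z₀ ξ k ω) := by
  induction k with
  | zero => exact hξ.initial.prodMk measurable_const
  | succ k ih =>
    have h1 : Measurable fun p : (E × ℝ) × (ℝ × (E → E)) =>
        (p.2.2 p.1.1, p.1.2 + |p.2.1| / totalRate R p.1.1) := by
      -- Evaluation at a varying state is jointly measurable because the state space is countable.
      have ha : Measurable fun p : E × (E → E) => p.2 p.1 :=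
        measurable_from_prod_countable_right fun z => measurable_pi_apply z
      have hb : Measurable (totalRate R) := Measurable.of_discrete
      refine Measurable.prodMk ?_ ?_
      · exact ha.comp (f := fun p : (E × ℝ) × (ℝ × (E → E)) => (p.1.1, p.2.2)) (by fun_prop)
      · have hb' := hb.comp (f := fun p : (E × ℝ) × (ℝ × (E → E)) => p.1.1) (by fun_prop)
        have hc : Measurable fun p : (E × ℝ) × (ℝ × (E → E)) => |p.2.1| := by fun_prop
        exact (by fun_prop : Measurable fun p : (E × ℝ) × (ℝ × (E → E)) => p.1.2).add (hc.div hb')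
    exact h1.comp ((ih.mono (G.mono k.le_succ) le_rfl).prodMk (hξ.noise k))

omit [IsJumpRate R] in
lemma measurable_jumpState (k : ℕ) : Measurable[G k] (jumpState R Z₀ ξ k) :=
  measurable_fst.comp (hξ.measurable_jumpChain k)

omit [IsJumpRate R] in
lemma measurable_jumpTime (k : ℕ) : Measurable[G k] (jumpTime R Z₀ ξ k) :=
  measurable_snd.comp (hξ.measurable_jumpChain k)

omit [IsJumpRate R] in
lemma measurable_jumpState' (k : ℕ) : Measurable (jumpState R Z₀ ξ k) :=
  (hξ.measurable_jumpState k).mono (G.le k) le_rfl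

omit [IsJumpRate R] in
lemma measurable_jumpTime' (k : ℕ) : Measurable (jumpTime R Z₀ ξ k) :=
  (hξ.measurable_jumpTime k).mono (G.le k) le_rfl

omit [Countable E] [MeasurableSingletonClass E] [IsJumpRate R] in
lemma measurable_noise (k : ℕ) : Measurable (ξ k) := (hξ.noise k).mono (G.le _) le_rfl

omit [Countable E] [MeasurableSingletonClass E] in
/-- A function of the past and of the next noise has mean zero if it does for every fixed past. -/
lemma integral_eq_zero [IsProbabilityMeasure P] {k : ℕ} {S : Type*} [MeasurableSpace S]
    {Y : Ω → S} (hY : Measurable[G k] Y) {Φ : S × (ℝ × (E → E)) → ℝ} (hΦ : Measurable Φ) {C : ℝ}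
    (hC : ∀ x, |Φ x| ≤ C) (h0 : ∀ y, ∫ x, Φ (y, x) ∂(noiseLaw R) = 0) :
    ∫ ω, Φ (Y ω, ξ k ω) ∂P = 0 := by
  have hY' : Measurable Y := hY.mono (G.le k) le_rfl
  have hind : IndepFun Y (ξ k) P := by
    rw [IndepFun_iff_Indep]
    exact indep_of_indep_of_le_left (hξ.indep k) hY.comap_le
  have hmap := (indepFun_iff_map_prod_eq_prod_map_map hY'.aemeasurable
    (hξ.measurable_noise k).aemeasurable).1 hind
  have := Measure.isProbabilityMeasure_map (μ := P) hY'.aemeasurable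
  rw [← integral_map (φ := fun ω => (Y ω, ξ k ω)) (hY'.prodMk (hξ.measurable_noise k)).aemeasurable
    hΦ.aestronglyMeasurable, hmap, hξ.law k, integral_prod]
  · simp [h0]
  · exact Integrable.of_bound hΦ.aestronglyMeasurable (C := C) (ae_of_all _ hC)

end IsJumpNoise

variable (R Z₀ ξ) in
/-- The events which, before each jump, can be expressed by the information available after the
previous jump. -/
def jumpFiltration (G : Filtration ℕ mΩ) : Filtration ℝ≥0 mΩ where
  seq t :=
    { MeasurableSet' := fun A => MeasurableSet A ∧ ∀ k, ∃ A', MeasurableSet[G k] A' ∧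
        A ∩ {ω | t < jumpTime R Z₀ ξ (k + 1) ω} = A' ∩ {ω | t < jumpTime R Z₀ ξ (k + 1) ω}
      measurableSet_empty := ⟨.empty, fun _ => ⟨∅, @MeasurableSet.empty _ (_), rfl⟩⟩
      measurableSet_compl := fun A hA => ⟨hA.1.compl, fun k => by
        obtain ⟨A', h1, h2⟩ := hA.2 k
        refine ⟨A'ᶜ, @MeasurableSet.compl _ _ (_) h1, ?_⟩
        rw [← Set.sdiff_eq_compl_inter, ← Set.sdiff_eq_compl_inter, ← Set.sdiff_inter_self_eq_sdiff, h2,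
          Set.sdiff_inter_self_eq_sdiff]⟩
      measurableSet_iUnion := fun A hA => ⟨.iUnion fun i => (hA i).1, fun k => by
        choose A' h1 h2 using fun i => (hA i).2 k
        refine ⟨⋃ i, A' i, @MeasurableSet.iUnion _ _ (_) _ _ h1, ?_⟩
        simp only [Set.iUnion_inter, h2]⟩ }
  mono' s t hst A hA := ⟨hA.1, fun k => by
    obtain ⟨A', h1, h2⟩ := hA.2 k
    refine ⟨A', h1, ?_⟩
    have : {ω | (t : ℝ) < jumpTime R Z₀ ξ (k + 1) ω}
        = {ω | s < jumpTime R Z₀ ξ (k + 1) ω} ∩ {ω | t < jumpTime R Z₀ ξ (k + 1) ω} := by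
      ext ω
      simp only [Set.mem_inter_iff, Set.mem_ofPred_eq, iff_and_self]
      exact (NNReal.coe_le_coe.2 hst).trans_lt
    rw [this, ← Set.inter_assoc, h2, Set.inter_assoc]⟩
  le' t A hA := hA.1

omit [Countable E] [MeasurableSingletonClass E] [IsJumpRate R] in
-- Criterion for adaptedness: before each jump, the function has to agree with one that is
-- determined by the information after the previous jump.
lemma measurable_jumpFiltration {β : Type*} [MeasurableSpace β] {t : ℝ≥0} {h : Ω → β}
    (hm : Measurable h) (h' : ∀ k, ∃ h' : Ω → β, Measurable[G k] h' ∧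
      ∀ ω, t < jumpTime R Z₀ ξ (k + 1) ω → h ω = h' ω) :
    Measurable[jumpFiltration R Z₀ ξ G t] h := by
  intro A hA
  refine ⟨hm hA, fun k => ?_⟩
  obtain ⟨h', h1, h2⟩ := h' k
  refine ⟨h' ⁻¹' A, h1 hA, ?_⟩
  ext ω
  simp only [Set.mem_inter_iff, Set.mem_preimage, Set.mem_ofPred_eq]
  exact and_congr_left fun h => by rw [h2 ω h]

end JumpProcess

/-! ### Measurability and adaptedness of the jump process -/

section JumpProcess

variable {E : Type*} [MeasurableSpace E] [Countable E] [MeasurableSingletonClass E]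
  {Ω : Type*} {mΩ : MeasurableSpace Ω} {R : E → Measure E} [IsJumpRate R] {P : Measure Ω}
  {G : Filtration ℕ mΩ} {Z₀ : Ω → E} {ξ : ℕ → Ω → ℝ × (E → E)}

lemma measurable_jumpIndex {S : Type*} [MeasurableSpace S] {T : ℕ → S → ℝ}
    (hT : ∀ k, Measurable (T k)) {u : S → ℝ} (hu : Measurable u) :
    Measurable fun x => jumpIndex (fun k => T k x) (u x) := by
  have hlt : ∀ k, MeasurableSet {x | u x < T k x} := fun k => measurableSet_lt hu (hT k)
  refine measurable_to_countable' fun k => ?_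
  -- The second set accounts for the default index 0 when no jump time exceeds u.
  have : (fun x => jumpIndex (fun k => T k x) (u x)) ⁻¹' {k}
      = ({x | u x < T (k + 1) x} ∩ ⋂ j ∈ Finset.range k, {x | u x < T (j + 1) x}ᶜ)
        ∪ ({x | k = 0} ∩ ⋂ j : ℕ, {x | u x < T (j + 1) x}ᶜ) := by
    ext x
    simp only [Set.mem_preimage, Set.mem_singleton_iff, Set.mem_union, Set.mem_inter_iff,
      Set.mem_ofPred_eq, Set.mem_iInter, Set.mem_compl_iff, Finset.mem_range]
    constructor
    · rintro rfl
      by_cases hne : {k | u x < T (k + 1) x}.Nonempty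
      · exact Or.inl ⟨Nat.sInf_mem hne, fun j hj hj' => (Nat.sInf_le hj').not_gt hj⟩
      · rw [Set.not_nonempty_iff_eq_empty] at hne
        refine Or.inr ⟨by simp [jumpIndex, hne], fun j hj => ?_⟩
        exact (hne ▸ hj : j ∈ (∅ : Set ℕ))
    · rintro (⟨h1, h2⟩ | ⟨rfl, h⟩)
      · refine le_antisymm (Nat.sInf_le h1) (not_lt.1 fun h => h2 _ h ?_)
        exact Nat.sInf_mem (s := {k | u x < T (k + 1) x}) ⟨k, h1⟩
      · have : {k | u x < T (k + 1) x} = ∅ := Set.eq_empty_of_forall_notMem h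
        simp [jumpIndex, this]
  rw [this]
  exact ((hlt _).inter (Finset.measurableSet_biInter _ fun j _ => (hlt _).compl)).union
    ((MeasurableSet.const _).inter (.iInter fun j => (hlt _).compl))

namespace IsJumpNoise

variable (hξ : IsJumpNoise R P G Z₀ ξ)
include hξ

omit [IsJumpRate R] in
lemma measurable_jumpProcess_uncurry :
    Measurable fun p : ℝ≥0 × Ω => jumpProcess R Z₀ ξ p.1 p.2 := by
  have h1 : Measurable fun p : ℝ≥0 × Ω =>
      jumpIndex (fun k => jumpTime R Z₀ ξ k p.2) (p.1 : ℝ) :=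
    measurable_jumpIndex (fun k => (hξ.measurable_jumpTime' k).comp measurable_snd) (by fun_prop)
  have h2 : Measurable fun p : ℕ × Ω => jumpState R Z₀ ξ p.1 p.2 :=
    measurable_from_prod_countable_right hξ.measurable_jumpState'
  exact h2.comp (h1.prodMk measurable_snd)

omit [IsJumpRate R] in
lemma measurable_jumpProcess (t : ℝ≥0) : Measurable (jumpProcess R Z₀ ξ t) :=
  hξ.measurable_jumpProcess_uncurry.comp measurable_prodMk_left

lemma measurable_jumpProcess_jumpFiltration (t : ℝ≥0) :
    Measurable[jumpFiltration R Z₀ ξ G t] (jumpProcess R Z₀ ξ t) := by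
  refine measurable_jumpFiltration (hξ.measurable_jumpProcess t) fun k => ?_
  induction k with
  | zero =>
    refine ⟨Z₀, hξ.initial, fun ω h => ?_⟩
    rw [jumpProcess, jumpIndex_eq (monotone_jumpTime ω) (k := 0) (by simp) h]
    rfl
  | succ k ih =>
    obtain ⟨h', h1, h2⟩ := ih
    classical
    -- Before jump k + 2, either jump k + 1 is still to come and the previous step applies, or the
    -- process sits in state k + 1.
    refine ⟨fun ω => if t < jumpTime R Z₀ ξ (k + 1) ω then h' ω else jumpState R Z₀ ξ (k + 1) ω,
      Measurable.ite ?_ (h1.mono (G.mono k.le_succ) le_rfl) (hξ.measurable_jumpState _),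
      fun ω h => ?_⟩
    · exact hξ.measurable_jumpTime (k + 1) measurableSet_Ioi
    · dsimp only
      split_ifs with hk
      · exact h2 ω hk
      · rw [jumpProcess, jumpIndex_eq (monotone_jumpTime ω) (not_lt.1 hk) h]

omit [IsJumpRate R] in
lemma measurable_integral_jumpProcess (g : E → ℝ) (t : ℝ≥0) :
    Measurable fun ω => ∫ s in (0 : ℝ)..t, g (jumpProcess R Z₀ ξ s.toNNReal ω) := by
  have h : Measurable fun p : Ω × ℝ => g (jumpProcess R Z₀ ξ p.2.toNNReal p.1) :=
    (Measurable.of_discrete (f := g)).comp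
      (hξ.measurable_jumpProcess_uncurry.comp (f := fun p : Ω × ℝ => (p.2.toNNReal, p.1))
        (by fun_prop))
  simp_rw [intervalIntegral.integral_of_le t.coe_nonneg]
  exact h.stronglyMeasurable.integral_prod_right.measurable

omit hξ [Countable E] [MeasurableSingletonClass E] in
lemma integral_jumpProcess (g : E → ℝ) {s t : ℝ≥0} (hst : s ≤ t) {K : ℕ} {ω : Ω}
    (hK : t < jumpTime R Z₀ ξ K ω) :
    IntervalIntegrable (fun v => g (jumpProcess R Z₀ ξ v.toNNReal ω)) volume s t ∧
    ∫ v in (s : ℝ)..t, g (jumpProcess R Z₀ ξ v.toNNReal ω)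
      = ∑ k ∈ Finset.range K, g (jumpState R Z₀ ξ k ω)
        * (max (s : ℝ) (min (jumpTime R Z₀ ξ (k + 1) ω) t)
          - max (s : ℝ) (min (jumpTime R Z₀ ξ k ω) t)) := by
  obtain ⟨h1, h2⟩ := integral_jumpIndex (monotone_jumpTime (R := R) (Z₀ := Z₀) (ξ := ξ) ω)
    (s := s) (by simp) (NNReal.coe_le_coe.2 hst) hK fun k => g (jumpState R Z₀ ξ k ω)
  have h : ∀ v ∈ Set.uIoc (s : ℝ) t, g (jumpState R Z₀ ξ
      (jumpIndex (fun k => jumpTime R Z₀ ξ k ω) v) ω) = g (jumpProcess R Z₀ ξ v.toNNReal ω) := by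
    intro v hv
    rw [Set.uIoc_of_le (NNReal.coe_le_coe.2 hst)] at hv
    rw [jumpProcess, Real.coe_toNNReal _ (s.coe_nonneg.trans hv.1.le)]
  refine ⟨h1.congr h, ?_⟩
  rw [← h2, intervalIntegral.integral_congr_ae (ae_of_all _ h)]

lemma measurable_integral_jumpFiltration (g : E → ℝ) (t : ℝ≥0) :
    Measurable[jumpFiltration R Z₀ ξ G t]
      fun ω => ∫ s in (0 : ℝ)..t, g (jumpProcess R Z₀ ξ s.toNNReal ω) := by
  refine measurable_jumpFiltration (hξ.measurable_integral_jumpProcess g t) fun k => ?_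
  refine ⟨fun ω => ∑ j ∈ Finset.range k, g (jumpState R Z₀ ξ j ω)
      * (max 0 (min (jumpTime R Z₀ ξ (j + 1) ω) t) - max 0 (min (jumpTime R Z₀ ξ j ω) t))
      + g (jumpState R Z₀ ξ k ω) * (t - max 0 (min (jumpTime R Z₀ ξ k ω) t)), ?_, fun ω h => ?_⟩
  · have hS : ∀ j ≤ k, Measurable[G k] fun ω => g (jumpState R Z₀ ξ j ω) := fun j hj =>
      (Measurable.of_discrete (f := g)).comp
        ((hξ.measurable_jumpState j).mono (G.mono hj) le_rfl)
    have hT : ∀ j ≤ k, Measurable[G k] fun ω => max 0 (min (jumpTime R Z₀ ξ j ω) t) := fun j hj =>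
      (by fun_prop : Measurable fun x : ℝ => max 0 (min x (t : ℝ))).comp
        ((hξ.measurable_jumpTime j).mono (G.mono hj) le_rfl)
    refine Measurable.add (Finset.measurable_fun_sum _ fun j hj => ?_)
      ((hS k le_rfl).mul (measurable_const.sub (hT k le_rfl)))
    have hj' := Finset.mem_range.1 hj
    exact (hS j hj'.le).mul ((hT (j + 1) hj').sub (hT j hj'.le))
  · have := (integral_jumpProcess g (zero_le : 0 ≤ t) h).2
    rw [NNReal.coe_zero] at this
    rw [this, Finset.sum_range_succ, min_eq_right h.le, max_eq_right t.coe_nonneg]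

end IsJumpNoise

end JumpProcess

/-! ### Dynkin's martingale -/

section JumpProcess

variable {E : Type*} [MeasurableSpace E]
  {Ω : Type*} {mΩ : MeasurableSpace Ω} {R : E → Measure E} {P : Measure Ω}
  {G : Filtration ℕ mΩ} {Z₀ : Ω → E} {ξ : ℕ → Ω → ℝ × (E → E)}

variable (R Z₀ ξ) in
/-- The increment in the time interval `(s, t]`, between the `k`-th jump and the next one, of the
process `f (X t) - ∫₀ᵗ L f (X u) du`, where `L` is the generator. -/
noncomputable def dynkinIncrement (f : E → ℝ) (s t : ℝ≥0) (k : ℕ) (ω : Ω) : ℝ :=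
  (Set.Ioc (s : ℝ) t).indicator (1 : ℝ → ℝ) (jumpTime R Z₀ ξ (k + 1) ω)
      * (f (jumpState R Z₀ ξ (k + 1) ω) - f (jumpState R Z₀ ξ k ω))
    - jumpGenerator R f (jumpState R Z₀ ξ k ω)
      * (max (s : ℝ) (min (jumpTime R Z₀ ξ (k + 1) ω) t)
        - max (s : ℝ) (min (jumpTime R Z₀ ξ k ω) t))

variable (R Z₀ ξ) in
/-- The process `f (X t) - ∫₀ᵗ L f (X u) du`, where `L` is the generator. -/
noncomputable def dynkinProcess (f : E → ℝ) (t : ℝ≥0) (ω : Ω) : ℝ :=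
  f (jumpProcess R Z₀ ξ t ω)
    - ∫ s in (0 : ℝ)..t, jumpGenerator R f (jumpProcess R Z₀ ξ s.toNNReal ω)

variable [IsJumpRate R] {f : E → ℝ} {C D : ℝ} {s t : ℝ≥0}

lemma sum_dynkinIncrement (hst : s ≤ t) {K : ℕ} {ω : Ω} (hK : t < jumpTime R Z₀ ξ K ω) :
    ∑ k ∈ Finset.range K, dynkinIncrement R Z₀ ξ f s t k ω
      = dynkinProcess R Z₀ ξ f t ω - dynkinProcess R Z₀ ξ f s ω := by
  have hst' : (s : ℝ) ≤ t := NNReal.coe_le_coe.2 hst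
  have hs : s < jumpTime R Z₀ ξ K ω := hst'.trans_lt hK
  simp only [dynkinIncrement, Finset.sum_sub_distrib]
  rw [← (IsJumpNoise.integral_jumpProcess (jumpGenerator R f) hst hK).2,
    sum_range_indicator_sub_of_lt (monotone_jumpTime ω) (by simp) hst' hK
      (fun k => f (jumpState R Z₀ ξ k ω))]
  have hi := (IsJumpNoise.integral_jumpProcess (jumpGenerator R f) (zero_le : 0 ≤ s) hs).1
  have := intervalIntegral.integral_add_adjacent_intervals hi
    (IsJumpNoise.integral_jumpProcess (jumpGenerator R f) hst hK).1
  rw [NNReal.coe_zero] at this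
  simp only [dynkinProcess, jumpProcess] at this ⊢
  linarith

omit [IsJumpRate R] in
lemma abs_clamp_sub_le {a b s t : ℝ} (hst : s ≤ t) :
    |max s (min a t) - max s (min b t)| ≤ t - s := by
  have h (a : ℝ) : s ≤ max s (min a t) ∧ max s (min a t) ≤ t :=
    ⟨le_max_left _ _, max_le hst (min_le_right _ _)⟩
  have h1 := h a
  have h2 := h b
  rw [abs_sub_le_iff]
  constructor <;> linarith [h1.1, h1.2, h2.1, h2.2]

/-- The jumps of f telescope to a difference of two values of f, and the holding times inside (s, t]
add up to at most t - s. The bound does not depend on K, which makes it the dominating constant for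
the limit over K. -/
lemma abs_sum_dynkinIncrement_le (hC : ∀ z, |f z| ≤ C) (hD : ∀ z, |jumpGenerator R f z| ≤ D)
    (hst : s ≤ t) (K : ℕ) {ω : Ω} (h : ∃ k, t < jumpTime R Z₀ ξ k ω) :
    |∑ k ∈ Finset.range K, dynkinIncrement R Z₀ ξ f s t k ω| ≤ (C + C) + D * (t - s) := by
  have hst' : (s : ℝ) ≤ t := NNReal.coe_le_coe.2 hst
  simp only [dynkinIncrement, Finset.sum_sub_distrib]
  rw [sum_range_indicator_sub (monotone_jumpTime ω) hst' h (fun k => f (jumpState R Z₀ ξ k ω))]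
  refine (abs_sub _ _).trans (add_le_add ((abs_sub _ _).trans (add_le_add (hC _) (hC _))) ?_)
  refine (Finset.abs_sum_le_sum_abs _ _).trans ?_
  have hm : ∀ k, 0 ≤ max (s : ℝ) (min (jumpTime R Z₀ ξ (k + 1) ω) t)
      - max (s : ℝ) (min (jumpTime R Z₀ ξ k ω) t) := fun k =>
    sub_nonneg.2 (max_le_max le_rfl (min_le_min (monotone_jumpTime ω k.le_succ) le_rfl))
  have hD0 : 0 ≤ D := (abs_nonneg _).trans (hD (Z₀ ω))
  calc _ ≤ ∑ k ∈ Finset.range K, D * (max (s : ℝ) (min (jumpTime R Z₀ ξ (k + 1) ω) t)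
        - max (s : ℝ) (min (jumpTime R Z₀ ξ k ω) t)) := by
        refine Finset.sum_le_sum fun k _ => ?_
        rw [abs_mul, abs_of_nonneg (hm k)]
        exact mul_le_mul_of_nonneg_right (hD _) (hm k)
    _ ≤ D * (t - s) := by
        rw [← Finset.mul_sum, Finset.sum_range_sub
          (fun k => max (s : ℝ) (min (jumpTime R Z₀ ξ k ω) t))]
        exact mul_le_mul_of_nonneg_left ((le_abs_self _).trans (abs_clamp_sub_le hst')) hD0

lemma dynkinIncrement_eq_zero {k : ℕ} {ω : Ω}
    (h : ¬ s < jumpTime R Z₀ ξ (k + 1) ω) : dynkinIncrement R Z₀ ξ f s t k ω = 0 := by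
  have h1 : jumpTime R Z₀ ξ k ω ≤ s := (monotone_jumpTime ω k.le_succ).trans (not_lt.1 h)
  rw [dynkinIncrement, Set.indicator_of_notMem (fun h' => h h'.1),
    max_eq_left ((min_le_left _ _).trans (not_lt.1 h)), max_eq_left ((min_le_left _ _).trans h1)]
  simp

variable [Countable E] [MeasurableSingletonClass E]

namespace IsJumpNoise

variable (hξ : IsJumpNoise R P G Z₀ ξ)
include hξ

omit [IsJumpRate R] in
lemma measurable_dynkinIncrement (k : ℕ) : Measurable (dynkinIncrement R Z₀ ξ f s t k) := by
  have hf : Measurable f := .of_discrete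
  have hg : Measurable (jumpGenerator R f) := .of_discrete
  have h1 := hξ.measurable_jumpTime' k
  have h2 := hξ.measurable_jumpTime' (k + 1)
  have h3 := hξ.measurable_jumpState' k
  have h4 := hξ.measurable_jumpState' (k + 1)
  have h5 : Measurable ((Set.Ioc (s : ℝ) t).indicator (1 : ℝ → ℝ)) :=
    measurable_one.indicator measurableSet_Ioc
  exact ((h5.comp h2).mul ((hf.comp h4).sub (hf.comp h3))).sub ((hg.comp h3).mul
    (by fun_prop))

/-- Unless jump k + 1 comes after s, the increment vanishes. On that event A coincides with a set A'
known after k jumps, so A can be replaced by A', and the next noise is independent of A'. -/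
lemma setIntegral_dynkinIncrement [IsProbabilityMeasure P] (hC : ∀ z, |f z| ≤ C)
    (hD : ∀ z, |jumpGenerator R f z| ≤ D) (hst : s ≤ t) {A : Set Ω}
    (hA : MeasurableSet[jumpFiltration R Z₀ ξ G s] A) (k : ℕ) :
    ∫ ω in A, dynkinIncrement R Z₀ ξ f s t k ω ∂P = 0 := by
  have hst' : (s : ℝ) ≤ t := NNReal.coe_le_coe.2 hst
  have hf : Measurable f := .of_discrete
  have hg : Measurable (jumpGenerator R f) := .of_discrete
  have hq : Measurable (totalRate R) := .of_discrete
  obtain ⟨hAm, hA'⟩ := hA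
  obtain ⟨A', hA'm, hAA'⟩ := hA' k
  let Y : Ω → ℝ × (E × ℝ) := fun ω =>
    (A'.indicator (fun _ => 1) ω, (jumpState R Z₀ ξ k ω, jumpTime R Z₀ ξ k ω))
  have hY : Measurable[G k] Y :=
    Measurable.prodMk (Measurable.indicator (@measurable_const ℝ Ω _ (G k) 1) hA'm)
      (hξ.measurable_jumpChain k)
  let Ψ : (E × ℝ) × (ℝ × (E → E)) → ℝ := fun p =>
    (Set.Ioc (s : ℝ) t).indicator (1 : ℝ → ℝ) (p.1.2 + |p.2.1| / totalRate R p.1.1)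
        * (f (p.2.2 p.1.1) - f p.1.1)
      - jumpGenerator R f p.1.1
        * (max (s : ℝ) (min (p.1.2 + |p.2.1| / totalRate R p.1.1) t) - max (s : ℝ) (min p.1.2 t))
  have hΨ : Measurable Ψ := by
    have ha : Measurable fun p : (E × ℝ) × (ℝ × (E → E)) => p.2.2 p.1.1 :=
      (measurable_from_prod_countable_right fun z => measurable_pi_apply z :
        Measurable fun p : E × (E → E) => p.2 p.1).comp
        (f := fun p : (E × ℝ) × (ℝ × (E → E)) => (p.1.1, p.2.2)) (by fun_prop)
    have hb : Measurable fun p : (E × ℝ) × (ℝ × (E → E)) =>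
        p.1.2 + |p.2.1| / totalRate R p.1.1 := by fun_prop
    have h5 : Measurable ((Set.Ioc (s : ℝ) t).indicator (1 : ℝ → ℝ)) :=
      measurable_one.indicator measurableSet_Ioc
    exact ((h5.comp hb).mul ((hf.comp ha).sub (by fun_prop))).sub
      (Measurable.mul (by fun_prop) (by fun_prop))
  have hΨb : ∀ p, |Ψ p| ≤ 1 * (C + C) + D * (t - s) := fun p => by
    refine (abs_sub _ _).trans (add_le_add ?_ ?_)
    · rw [abs_mul]
      refine mul_le_mul ?_ ((abs_sub _ _).trans (add_le_add (hC _) (hC _))) (abs_nonneg _)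
        zero_le_one
      exact (norm_indicator_le_norm_self (1 : ℝ → ℝ) _).trans (by simp)
    · rw [abs_mul]
      exact mul_le_mul (hD _) (abs_clamp_sub_le hst') (abs_nonneg _) ((abs_nonneg _).trans (hD p.1.1))
  -- The membership in A' is carried by a real coordinate; composing with the indicator of {1} keeps
  -- the integrand bounded at all values of that coordinate.
  have hI : Measurable (({1} : Set ℝ).indicator (1 : ℝ → ℝ)) :=
    measurable_one.indicator (measurableSet_singleton 1)
  have key := hξ.integral_eq_zero hY
    (Φ := fun p => ({1} : Set ℝ).indicator (1 : ℝ → ℝ) p.1.1 * Ψ (p.1.2, p.2))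
    ((hI.comp (by fun_prop)).mul (hΨ.comp (by fun_prop))) (C := 1 * (1 * (C + C) + D * (t - s)))
    (fun p => by
      rw [abs_mul]
      refine mul_le_mul ?_ (hΨb _) (abs_nonneg _) zero_le_one
      exact (norm_indicator_le_norm_self (1 : ℝ → ℝ) _).trans (by simp))
    (fun y => by
      have h0 : ∫ x, Ψ (y.2, x) ∂(noiseLaw R) = 0 :=
        integral_noiseLaw_jump R hf hC hst' y.2.1 y.2.2
      exact (integral_const_mul (({1} : Set ℝ).indicator (1 : ℝ → ℝ) y.1) _).trans
        (by rw [h0, mul_zero]))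
  rw [← integral_indicator hAm, ← key]
  refine integral_congr_ae (ae_of_all _ fun ω => ?_)
  have hΔ : Ψ (((jumpState R Z₀ ξ k ω), jumpTime R Z₀ ξ k ω), ξ k ω)
    = dynkinIncrement R Z₀ ξ f s t k ω := rfl
  simp only [Y, hΔ]
  by_cases h : s < jumpTime R Z₀ ξ (k + 1) ω
  · have : ω ∈ A ↔ ω ∈ A' := by
      have := Set.ext_iff.1 hAA' ω
      simpa [h] using this
    by_cases hω : ω ∈ A
    · simp [hω, this.1 hω]
    · simp [hω, mt this.2 hω]
  · simp [dynkinIncrement_eq_zero h, Set.indicator_apply]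

lemma measurable_dynkinProcess (t : ℝ≥0) :
    Measurable[jumpFiltration R Z₀ ξ G t] (dynkinProcess R Z₀ ξ f t) := by
  have hf : Measurable f := .of_discrete
  exact (hf.comp (hξ.measurable_jumpProcess_jumpFiltration t)).sub
    (hξ.measurable_integral_jumpFiltration _ t)

lemma integrable_dynkinProcess [IsProbabilityMeasure P] (hC : ∀ z, |f z| ≤ C)
    (hD : ∀ z, |jumpGenerator R f z| ≤ D) (t : ℝ≥0) : Integrable (dynkinProcess R Z₀ ξ f t) P := by
  have hm : Measurable (dynkinProcess R Z₀ ξ f t) :=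
    (hξ.measurable_dynkinProcess t).mono ((jumpFiltration R Z₀ ξ G).le t) le_rfl
  refine Integrable.of_bound hm.aestronglyMeasurable (C + D * |(t : ℝ) - 0|) (ae_of_all _ fun ω => ?_)
  exact (norm_sub_le _ _).trans (add_le_add (hC _)
    (intervalIntegral.norm_integral_le_of_norm_le_const fun _ _ => hD _))

theorem martingale_dynkinProcess [IsProbabilityMeasure P] (hne : IsNonexplosive R Z₀ ξ P)
    (hC : ∀ z, |f z| ≤ C) (hD : ∀ z, |jumpGenerator R f z| ≤ D) :
    Martingale (dynkinProcess R Z₀ ξ f) (jumpFiltration R Z₀ ξ G) P := by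
  refine ⟨fun t => (hξ.measurable_dynkinProcess t).stronglyMeasurable, fun s t hst => ?_⟩
  have hint := hξ.integrable_dynkinProcess hC hD
  refine (ae_eq_condExp_of_forall_setIntegral_eq ((jumpFiltration R Z₀ ξ G).le s) (hint t)
    (fun A _ _ => (hint s).integrableOn) (fun A hA _ => ?_)
    (hξ.measurable_dynkinProcess s).stronglyMeasurable.aestronglyMeasurable).symm
  rw [eq_comm, ← sub_eq_zero, ← integral_sub (hint t).integrableOn (hint s).integrableOn]
  have hlim := tendsto_integral_of_dominated_convergence (μ := P.restrict A)
    (F := fun K ω => ∑ k ∈ Finset.range K, dynkinIncrement R Z₀ ξ f s t k ω)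
    (f := fun ω => dynkinProcess R Z₀ ξ f t ω - dynkinProcess R Z₀ ξ f s ω)
    (fun _ => (C + C) + D * (t - s))
    (fun K => (Finset.measurable_fun_sum _ fun k _ =>
      hξ.measurable_dynkinIncrement k).aestronglyMeasurable)
    (integrable_const _)
    (fun K => ae_restrict_of_ae (hne.mono fun ω h => abs_sum_dynkinIncrement_le hC hD hst K (h t)))
    (ae_restrict_of_ae (hne.mono fun ω h => by
      obtain ⟨k, hk⟩ := h t
      refine tendsto_const_nhds.congr' ?_
      filter_upwards [eventually_ge_atTop k] with K hK
      exact (sum_dynkinIncrement hst (hk.trans_le (monotone_jumpTime ω hK))).symm))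
  refine tendsto_nhds_unique hlim (tendsto_const_nhds.congr fun K => ?_)
  -- A single increment is a difference of two consecutive partial sums, each of them bounded.
  have hi : ∀ k, Integrable (dynkinIncrement R Z₀ ξ f s t k) (P.restrict A) := fun k => by
    refine Integrable.of_bound (hξ.measurable_dynkinIncrement k).aestronglyMeasurable
      ((C + C + D * (t - s)) + (C + C + D * (t - s)))
      (ae_restrict_of_ae (hne.mono fun ω h => ?_))
    have h1 := abs_sum_dynkinIncrement_le (f := f) hC hD hst k (h t)
    have h2 := abs_sum_dynkinIncrement_le (f := f) hC hD hst (k + 1) (h t)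
    rw [Finset.sum_range_succ] at h2
    have := (abs_sub _ _).trans (add_le_add h2 h1)
    rwa [add_sub_cancel_left] at this
  rw [integral_finsetSum _ fun k _ => hi k]
  simp [hξ.setIntegral_dynkinIncrement hC hD hst hA]

end IsJumpNoise

end JumpProcess

section JumpProcess

variable {E : Type*} [MeasurableSpace E]
  {Ω : Type*} {mΩ : MeasurableSpace Ω} {R : E → Measure E} {P : Measure Ω}
  {G : Filtration ℕ mΩ} {Z₀ : Ω → E} {ξ : ℕ → Ω → ℝ × (E → E)}

/-! ### Paths of the jump process -/

lemma jumpProcess_rightContinuous [IsJumpRate R] {ω : Ω}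
    (h : ∀ t : ℝ, ∃ k, t < jumpTime R Z₀ ξ k ω) (t : ℝ≥0) :
    ∀ᶠ s in 𝓝[>] t, jumpProcess R Z₀ ξ s ω = jumpProcess R Z₀ ξ t ω := by
  have hc : Tendsto ((↑) : ℝ≥0 → ℝ) (𝓝[>] t) (𝓝[>] (t : ℝ)) :=
    NNReal.continuous_coe.continuousWithinAt.tendsto_nhdsWithin fun s hs => NNReal.coe_lt_coe.2 hs
  filter_upwards [hc.eventually (eventually_jumpIndex_right (monotone_jumpTime ω) (by simp) (h t))]
    with s hs
  rw [jumpProcess, jumpProcess, hs]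

lemma jumpProcess_leftLimit [IsJumpRate R] {ω : Ω}
    (h : ∀ t : ℝ, ∃ k, t < jumpTime R Z₀ ξ k ω) (t : ℝ≥0) :
    ∃ z, ∀ᶠ s in 𝓝[<] t, jumpProcess R Z₀ ξ s ω = z := by
  obtain rfl | ht := eq_or_ne t 0
  · exact ⟨Z₀ ω, by simp⟩
  have hc : Tendsto ((↑) : ℝ≥0 → ℝ) (𝓝[<] t) (𝓝[<] (t : ℝ)) :=
    NNReal.continuous_coe.continuousWithinAt.tendsto_nhdsWithin fun s hs => NNReal.coe_lt_coe.2 hs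
  obtain ⟨j, hj⟩ := exists_eventually_jumpIndex_left (monotone_jumpTime (R := R) (Z₀ := Z₀)
    (ξ := ξ) ω) (t := t) (by simpa [pos_iff_ne_zero] using ht) (h t)
  refine ⟨jumpState R Z₀ ξ j ω, ?_⟩
  filter_upwards [hc.eventually hj] with s hs
  rw [jumpProcess, hs]

lemma jumpProcess_of_invariant {I : E → Prop} {ω : Ω} (h0 : I (Z₀ ω))
    (h : ∀ k, I (jumpState R Z₀ ξ k ω) → I (jumpState R Z₀ ξ (k + 1) ω)) (t : ℝ≥0) :
    I (jumpProcess R Z₀ ξ t ω) := by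
  suffices ∀ k, I (jumpState R Z₀ ξ k ω) from this _
  intro k
  induction k with
  | zero => exact h0
  | succ k ih => exact h k ih

lemma monotone_jumpProcess [IsJumpRate R] {β : Type*} [Preorder β] {F : E → β} {ω : Ω}
    (hne : ∀ t : ℝ, ∃ k, t < jumpTime R Z₀ ξ k ω)
    (h : ∀ k, F (jumpState R Z₀ ξ k ω) ≤ F (jumpState R Z₀ ξ (k + 1) ω)) :
    Monotone fun t => F (jumpProcess R Z₀ ξ t ω) := fun _ t hst =>
  monotone_nat_of_le_succ h (jumpIndex_mono (monotone_jumpTime ω) (NNReal.coe_le_coe.2 hst) (hne t))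

/-! ### Absence of explosions -/

lemma integral_expMeasure_exp_neg_div {b : ℝ} (hb : 0 < b) :
    ∫ v, Real.exp (-(|v| / b)) ∂(expMeasure 1) = b / (b + 1) := by
  rw [integral_expMeasure_one]
  have hb' : -(1 + 1 / b) < 0 := by linarith [one_div_pos.2 hb]
  have h := integral_exp_mul_Ioi hb' 0
  have : ∫ v in Set.Ioi (0 : ℝ), Real.exp (-v) * Real.exp (-(|v| / b))
      = ∫ v in Set.Ioi (0 : ℝ), Real.exp (-(1 + 1 / b) * v) := by
    refine setIntegral_congr_fun measurableSet_Ioi fun v hv => ?_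
    rw [← Real.exp_add, abs_of_pos hv]
    congr 1
    ring
  rw [this, h, mul_zero, Real.exp_zero, neg_div_neg_eq]
  field_simp

namespace IsJumpNoise

variable (hξ : IsJumpNoise R P G Z₀ ξ)
include hξ

lemma integral_clock (k : ℕ) {f : ℝ → ℝ} (hf : Measurable f) [IsJumpRate R] :
    ∫ ω, f (ξ k ω).1 ∂P = ∫ v, f v ∂(expMeasure 1) := by
  have := isProbabilityMeasure_expMeasure one_pos
  have h1 : (P.map (ξ k)).map Prod.fst = expMeasure 1 := by
    rw [hξ.law, noiseLaw]
    simp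
  rw [← h1, integral_map measurable_fst.aemeasurable hf.aestronglyMeasurable,
    ← integral_map (f := fun x : ℝ × (E → E) => f x.1) (hξ.measurable_noise k).aemeasurable
      (hf.comp measurable_fst).aestronglyMeasurable]

/-- The factors (a + j) / (a + j + 1) are independent contributions whose product telescopes. -/
lemma integral_exp_neg_sum [IsJumpRate R] [IsProbabilityMeasure P] {a : ℝ} (ha : 0 < a) (n : ℕ) :
    ∫ ω, Real.exp (-∑ j ∈ Finset.range n, |(ξ j ω).1| / (a + j)) ∂P = a / (a + n) := by
  induction n with
  | zero => simp [ha.ne']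
  | succ n ih =>
    have han : 0 < a + n := by positivity
    have h1 : Measurable[G n] fun ω =>
        Real.exp (-∑ j ∈ Finset.range n, |(ξ j ω).1| / (a + j)) := by
      have hj : ∀ j ∈ Finset.range n, Measurable[G n] fun ω => |(ξ j ω).1| / (a + j) :=
        fun j hj => (by fun_prop : Measurable fun x : ℝ × (E → E) => |x.1| / (a + j)).comp
          ((hξ.noise j).mono (G.mono (Finset.mem_range.1 hj)) le_rfl)
      exact (by fun_prop : Measurable fun x : ℝ => Real.exp (-x)).comp
        (Finset.measurable_fun_sum _ hj)
    have hg : Measurable fun x : ℝ × (E → E) => Real.exp (-(|x.1| / (a + n))) := by fun_prop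
    have hind : IndepFun (fun ω => Real.exp (-∑ j ∈ Finset.range n, |(ξ j ω).1| / (a + j)))
        (fun ω => Real.exp (-(|(ξ n ω).1| / (a + n)))) P := by
      rw [IndepFun_iff_Indep]
      refine indep_of_indep_of_le_left (indep_of_indep_of_le_right (hξ.indep n) ?_) h1.comap_le
      exact (hg.comp (comap_measurable (ξ n))).comap_le
    have h2 := hind.integral_fun_mul_eq_mul_integral
      (h1.mono (G.le n) le_rfl).aestronglyMeasurable
      (hg.comp (hξ.measurable_noise n)).aestronglyMeasurable
    simp only [Finset.sum_range_succ, neg_add, Real.exp_add]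
    rw [h2, ih, hξ.integral_clock n (f := fun v => Real.exp (-(|v| / (a + n)))) (by fun_prop),
      integral_expMeasure_exp_neg_div han]
    push_cast
    field_simp
    rw [add_assoc]

/-- Chernoff bound: all partial sums stay below M with probability at most exp(M) a / (a + n), for
every n. -/
lemma ae_sum_div_unbounded [IsJumpRate R] [IsProbabilityMeasure P] {a : ℝ} (ha : 0 < a) :
    ∀ᵐ ω ∂P, ∀ M : ℝ, ∃ n, M < ∑ j ∈ Finset.range n, |(ξ j ω).1| / (a + j) := by
  have hS : ∀ n, Measurable fun ω => ∑ j ∈ Finset.range n, |(ξ j ω).1| / (a + j) := fun n =>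
    Finset.measurable_fun_sum _ fun j _ =>
      (by fun_prop : Measurable fun x : ℝ × (E → E) => |x.1| / (a + j)).comp (hξ.measurable_noise j)
  have key : ∀ M : ℕ, ∀ᵐ ω ∂P, ∃ n, (M : ℝ) < ∑ j ∈ Finset.range n, |(ξ j ω).1| / (a + j) := by
    intro M
    have hb : ∀ n : ℕ, P.real {ω | ¬ ∃ n, (M : ℝ) < ∑ j ∈ Finset.range n, |(ξ j ω).1| / (a + j)}
        ≤ a / (a + n) * Real.exp M := by
      intro n
      have h0 : ∀ ω, 0 ≤ ∑ j ∈ Finset.range n, |(ξ j ω).1| / (a + j) := fun ω =>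
        Finset.sum_nonneg fun j _ => by positivity
      have hm := mul_meas_ge_le_integral_of_nonneg (μ := P)
        (f := fun ω => Real.exp (-∑ j ∈ Finset.range n, |(ξ j ω).1| / (a + j)))
        (ae_of_all _ fun ω => (Real.exp_pos _).le)
        (Integrable.of_bound (hS n).neg.exp.aestronglyMeasurable 1 (ae_of_all _ fun ω => by
          simpa using h0 ω)) (Real.exp (-M))
      rw [hξ.integral_exp_neg_sum ha, Real.exp_neg, inv_mul_le_iff₀ (Real.exp_pos _),
        mul_comm (Real.exp _)] at hm
      refine le_trans (measureReal_mono fun ω hω => ?_) hm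
      simp only [Set.mem_ofPred_eq, not_exists, not_lt] at hω ⊢
      rw [← Real.exp_neg, Real.exp_le_exp]
      exact neg_le_neg (hω n)
    have hlim : Tendsto (fun n : ℕ => a / (a + n) * Real.exp M) atTop (𝓝 0) := by
      have : Tendsto (fun n : ℕ => a / (a + (n : ℝ))) atTop (𝓝 0) :=
        tendsto_const_nhds.div_atTop (tendsto_atTop_add_const_left _ _ tendsto_natCast_atTop_atTop)
      simpa using this.mul_const (Real.exp M)
    have h0 := le_antisymm (ge_of_tendsto' hlim hb) measureReal_nonneg
    rwa [measureReal_eq_zero_iff] at h0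
  filter_upwards [ae_all_iff.2 key] with ω hω M
  obtain ⟨m, hm⟩ := exists_nat_gt M
  exact (hω m).imp fun n hn => hm.trans hn

variable [Countable E] [MeasurableSingletonClass E] [IsJumpRate R]

omit [MeasurableSingletonClass E] in
/-- Almost surely, all jumps are jumps that are allowed by the rates. -/
lemma ae_jump {Q : E → E → Prop} (hQ : ∀ z, ∀ᵐ z' ∂(R z), Q z z') :
    ∀ᵐ ω ∂P, ∀ k, Q (jumpState R Z₀ ξ k ω) (jumpState R Z₀ ξ (k + 1) ω) := by
  have h1 : ∀ᵐ x ∂(noiseLaw R), ∀ z, Q z (x.2 z) := by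
    rw [ae_all_iff]
    intro z
    have h2 : ∀ᵐ z' ∂(jumpLaw R z), Q z z' := Measure.ae_smul_measure (hQ z) _
    rw [← Measure.infinitePi_map_eval (jumpLaw R) z] at h2
    exact Measure.quasiMeasurePreserving_snd.ae
      (ae_of_ae_map (measurable_pi_apply z).aemeasurable h2)
  rw [ae_all_iff]
  intro k
  rw [← hξ.law k] at h1
  filter_upwards [ae_of_ae_map (hξ.measurable_noise k).aemeasurable h1] with ω hω using hω _

omit [Countable E] [MeasurableSingletonClass E] in
-- Excludes a jump at time 0, so that the process starts in its initial state.
lemma ae_clock_pos : ∀ᵐ ω ∂P, 0 < jumpTime R Z₀ ξ 1 ω := by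
  have := isProbabilityMeasure_expMeasure one_pos
  have h1 : ∀ᵐ x ∂(noiseLaw R), 0 < x.1 :=
    Measure.quasiMeasurePreserving_fst.ae ae_pos_expMeasure_one
  rw [← hξ.law 0] at h1
  filter_upwards [ae_of_ae_map (hξ.measurable_noise 0).aemeasurable h1] with ω hω
  rw [jumpTime_succ, jumpTime_zero, zero_add]
  exact div_pos (abs_pos.2 hω.ne') (totalRate_pos R _)

omit [MeasurableSingletonClass E] in
/-- There are no explosions if the jump rate is at most linear in a quantity that grows by at
most one in a jump. -/
theorem isNonexplosive [IsProbabilityMeasure P] {h : E → ℕ} {c : ℝ} (hc : 0 < c)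
    (hq : ∀ z, totalRate R z ≤ c * (h z + 1)) (hh : ∀ z, ∀ᵐ z' ∂(R z), h z' ≤ h z + 1) :
    IsNonexplosive R Z₀ ξ P := by
  -- The initial size `h (Z₀ ω)` is random, so divergence is secured for all integer offsets
  -- simultaneously.
  have h1 : ∀ᵐ ω ∂P, ∀ m : ℕ, ∀ M : ℝ,
      ∃ n, M < ∑ j ∈ Finset.range n, |(ξ j ω).1| / ((m + 1 : ℝ) + j) :=
    ae_all_iff.2 fun m => hξ.ae_sum_div_unbounded (by positivity)
  filter_upwards [h1, hξ.ae_jump hh] with ω h1 h2 t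
  obtain ⟨n, hn⟩ := h1 (h (Z₀ ω)) (c * t)
  refine ⟨n, lt_of_mul_lt_mul_left (hn.trans_le ?_) hc.le⟩
  have hk : ∀ k, h (jumpState R Z₀ ξ k ω) ≤ h (Z₀ ω) + k := by
    intro k
    induction k with
    | zero => simp
    | succ k ih => exact (h2 k).trans (by omega)
  clear hn
  induction n with
  | zero => simp
  | succ n ih =>
    rw [Finset.sum_range_succ, jumpTime_succ, mul_add]
    refine add_le_add ih ?_
    rw [mul_div_assoc', div_le_div_iff₀ (by positivity) (totalRate_pos R _)]
    have hb : totalRate R (jumpState R Z₀ ξ n ω) ≤ c * ((h (Z₀ ω) + 1 : ℝ) + n) := by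
      refine (hq _).trans (mul_le_mul_of_nonneg_left ?_ hc.le)
      have : (h (jumpState R Z₀ ξ n ω) : ℝ) ≤ h (Z₀ ω) + n := by exact_mod_cast hk n
      linarith
    calc _ ≤ |(ξ n ω).1| * (c * ((h (Z₀ ω) + 1 : ℝ) + n)) :=
          mul_le_mul_of_nonneg_left hb (abs_nonneg _)
      _ = _ := by ring

end IsJumpNoise

/-- The information contained in the first terms of a sequence of random variables. -/
def sequenceFiltration {S : Type*} [MeasurableSpace S] (η : ℕ → Ω → S)
    (hη : ∀ k, Measurable (η k)) : Filtration ℕ mΩ where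
  seq k := ⨆ j ∈ Set.Iic k, MeasurableSpace.comap (η j) inferInstance
  mono' _ _ hkl := biSup_mono fun _ hj => le_trans hj hkl
  le' _ := iSup₂_le fun j _ => (hη j).comap_le

/-- Term 0 of the sequence is reserved for the initial state; term k + 1 drives jump number k and is
independent of the terms up to k. -/
lemma isJumpNoise_of_iIndepFun {S : Type*} [MeasurableSpace S] {η : ℕ → Ω → S}
    (hη : ∀ k, Measurable (η k)) (hind : iIndepFun η P) {φ : S → E} (hφ : Measurable φ)
    {ψ : S → ℝ × (E → E)} (hψ : Measurable ψ)
    (hlaw : ∀ k, P.map (fun ω => ψ (η (k + 1) ω)) = noiseLaw R) :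
    IsJumpNoise R P (sequenceFiltration η hη) (fun ω => φ (η 0 ω))
      (fun k ω => ψ (η (k + 1) ω)) := by
  have hm : ∀ k, Measurable[sequenceFiltration η hη k] (η k) := fun k => by
    refine (comap_measurable (η k)).mono ?_ le_rfl
    exact le_biSup (fun j => MeasurableSpace.comap (η j) inferInstance) (Set.mem_Iic.2 le_rfl)
  refine ⟨hφ.comp (hm 0), fun k => hψ.comp (hm (k + 1)), fun k => ?_, hlaw⟩
  have hd : Disjoint (Set.Iic k) {k + 1} := by simp
  have := indep_iSup_of_disjoint (fun k => (hη k).comap_le) hind hd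
  rw [iSup_singleton] at this
  exact indep_of_indep_of_le_right this (hψ.comp (comap_measurable (η (k + 1)))).comap_le

end JumpProcess

/-! ### Configurations -/

section Configuration

variable {N : ℕ}

/-- The number of tasks, if only the first `k` tasks of every pool are counted. -/
def load (k : ℕ) (x : Config N) : ℕ := ∑ n, min (x n) k

/-- The number of tasks in the pools that have at most `k` tasks. -/
def tasksInSmallPools (k : ℕ) (x : Config N) : ℕ := ∑ n, if x n ≤ k then x n else 0

/-- The number of pools with fewer active tasks than the pool `n`. -/
def poolsBelow (x : Config N) (n : Fin N) : ℕ := (Finset.univ.filter fun j => x j < x n).card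

lemma load_succ (k : ℕ) (x : Config N) : load (k + 1) x = load k x + occupancy (k + 1) x := by
  simp only [load, occupancy, Finset.card_filter, ← Finset.sum_add_distrib]
  refine Finset.sum_congr rfl fun n _ => ?_
  split_ifs <;> omega

/-- Checked pool by pool. It expresses the departure threshold of `load_depart` through two
consecutive loads, so that inequalities between loads control departures. -/
lemma tasksInSmallPools_add (k : ℕ) (x : Config N) :
    tasksInSmallPools k x + k * load (k + 1) x = (k + 1) * load k x := by
  simp only [load, tasksInSmallPools, Finset.mul_sum, ← Finset.sum_add_distrib]
  refine Finset.sum_congr rfl fun n _ => ?_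
  split_ifs with h
  · rw [min_eq_left h, min_eq_left (by omega)]; ring
  · rw [min_eq_right (by omega), min_eq_right (by omega)]; ring

lemma tasksInSmallPools_le (k : ℕ) (x : Config N) : tasksInSmallPools k x ≤ ∑ n, x n :=
  Finset.sum_le_sum fun n _ => by split_ifs <;> simp

/-- The pools of the tasks, sorted by the number of tasks in the pool. -/
noncomputable def taskList (x : Config N) : List (Fin N) :=
  (List.finRange N).flatMap fun i => List.replicate (x (Tuple.sort x i)) (Tuple.sort x i)

lemma sum_map_taskList (x : Config N) {M : Type*} [AddCommMonoid M] (F : Fin N → M) :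
    ((taskList x).map F).sum = ∑ n, x n • F n := by
  have h : ((taskList x).map F).sum = ∑ i, x (Tuple.sort x i) • F (Tuple.sort x i) := by
    rw [taskList, List.flatMap_def, List.map_flatten, List.sum_flatten, Fin.sum_univ_def]
    simp [Function.comp_def]
  rw [h, Equiv.sum_comp (Tuple.sort x) fun n => x n • F n]

lemma length_taskList (x : Config N) : (taskList x).length = ∑ n, x n := by
  have := sum_map_taskList x fun _ => 1
  simpa using this

lemma countP_taskList (k : ℕ) (x : Config N) :
    (taskList x).countP (fun n => x n ≤ k) = tasksInSmallPools k x := by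
  have := sum_map_taskList x fun n => if x n ≤ k then 1 else 0
  rw [tasksInSmallPools]
  simp only [smul_eq_mul, mul_ite, mul_one, mul_zero] at this
  rw [← this]
  generalize taskList x = l
  induction l with
  | nil => simp
  | cons a l ih => simp [List.countP_cons, ih]; split_ifs <;> omega

lemma pos_of_mem_taskList {x : Config N} {n : Fin N} (h : n ∈ taskList x) : 0 < x n := by
  simp only [taskList, List.mem_flatMap, List.mem_replicate] at h
  obtain ⟨i, -, h, rfl⟩ := h
  exact Nat.pos_of_ne_zero h

lemma pairwise_taskList (x : Config N) : (taskList x).Pairwise fun a b => x a ≤ x b := by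
  rw [taskList, List.pairwise_flatMap]
  refine ⟨fun i _ => List.pairwise_replicate.2 (Or.inr le_rfl), ?_⟩
  refine (List.pairwise_lt_finRange N).imp fun hij a ha b hb => ?_
  rw [(List.mem_replicate.1 ha).2, (List.mem_replicate.1 hb).2]
  exact Tuple.monotone_sort x hij.le

/-- In a sorted list the entries with F ≤ k form an initial segment. -/
lemma List.Pairwise.getElem_le_iff {α : Type*} {F : α → ℕ} {l : List α}
    (hl : l.Pairwise fun a b => F a ≤ F b) (k : ℕ) {u : ℕ} (hu : u < l.length) :
    F l[u] ≤ k ↔ u < l.countP fun a => F a ≤ k := by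
  induction l generalizing u with
  | nil => simp at hu
  | cons a l ih =>
    rw [List.pairwise_cons] at hl
    rw [List.countP_cons]
    by_cases ha : F a ≤ k
    · cases u with
      | zero => simp [ha]
      | succ u => simpa [ha] using ih hl.2 (by simpa using hu)
    · have h0 : l.countP (fun a => F a ≤ k) = 0 := by
        rw [List.countP_eq_zero]
        intro b hb
        have := hl.1 b hb
        simp; omega
      have : ¬ F (a :: l)[u] ≤ k := by
        cases u with
        | zero => exact ha
        | succ u =>
          have := hl.1 _ (List.getElem_mem (l := l) (n := u) (by simpa using hu))
          simp; omega
      simp [this, h0, ha]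

/-- The configuration after the completion of a task in the pool `n`. -/
def complete (x : Config N) (n : Fin N) : Config N := Function.update x n (x n - 1)

/-- The configuration after the completion of the task number `u` of the sorted list of tasks. -/
noncomputable def depart (x : Config N) (u : ℕ) : Config N :=
  ((taskList x)[u]?).elim x (complete x)

/-- The configuration after a task has been directed to the pool `n`. -/
noncomputable def arrive (B : ℕ∞) (x : Config N) (n : Fin N) : Config N :=
  Function.update x n (if (x n : ℕ∞) < B then x n + 1 else x n)

lemma complete_le (x : Config N) (n j : Fin N) : complete x n j ≤ x j := by
  rw [complete, Function.update_apply]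
  split_ifs with h
  · subst h; omega
  · rfl

lemma depart_le (x : Config N) (u : ℕ) (j : Fin N) : depart x u j ≤ x j := by
  rw [depart]
  cases (taskList x)[u]? with
  | none => rfl
  | some n => exact complete_le x n j

lemma load_update (k : ℕ) (x : Config N) (n : Fin N) (v : ℕ) :
    load k (Function.update x n v) + min (x n) k = load k x + min v k := by
  rw [load, load, ← Finset.add_sum_erase _ _ (Finset.mem_univ n),
    ← Finset.add_sum_erase _ (fun j => min (x j) k) (Finset.mem_univ n), Function.update_self]
  have : ∑ j ∈ Finset.univ.erase n, min (Function.update x n v j) k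
      = ∑ j ∈ Finset.univ.erase n, min (x j) k :=
    Finset.sum_congr rfl fun j hj => by rw [Function.update_of_ne (Finset.ne_of_mem_erase hj)]
  omega

lemma sum_update (x : Config N) (n : Fin N) (v : ℕ) :
    ∑ j, Function.update x n v j + x n = ∑ j, x j + v := by
  rw [← Finset.add_sum_erase _ _ (Finset.mem_univ n),
    ← Finset.add_sum_erase _ (fun j => x j) (Finset.mem_univ n), Function.update_self]
  have : ∑ j ∈ Finset.univ.erase n, Function.update x n v j = ∑ j ∈ Finset.univ.erase n, x j :=
    Finset.sum_congr rfl fun j hj => by rw [Function.update_of_ne (Finset.ne_of_mem_erase hj)]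
  omega

/-- A completion lowers `load k` iff its pool has at most k tasks, and by the sorting those tasks
occupy the first `tasksInSmallPools k x` positions. -/
lemma load_depart (k : ℕ) (x : Config N) (u : ℕ) :
    load k (depart x u) + (if u < tasksInSmallPools k x then 1 else 0) = load k x := by
  rw [depart]
  by_cases hu : u < (taskList x).length
  · rw [List.getElem?_eq_getElem hu, ← countP_taskList]
    have h1 := (pairwise_taskList x).getElem_le_iff k hu
    have h2 := pos_of_mem_taskList (List.getElem_mem hu)
    have h3 := load_update k x (taskList x)[u] (x (taskList x)[u] - 1)
    simp only [← h1, Option.elim_some, complete]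
    split_ifs <;> omega
  · rw [List.getElem?_eq_none (not_lt.1 hu), if_neg]
    · rfl
    · rw [length_taskList] at hu
      exact fun h => hu (h.trans_le (tasksInSmallPools_le k x))

lemma load_arrive (B : ℕ∞) (k : ℕ) (x : Config N) (n : Fin N) :
    load k (arrive B x n) = load k x + if x n < k ∧ (x n : ℕ∞) < B then 1 else 0 := by
  have := load_update k x n (if (x n : ℕ∞) < B then x n + 1 else x n)
  rw [arrive]
  by_cases h : (x n : ℕ∞) < B
  · simp only [h, if_true, and_true] at this ⊢
    split_ifs <;> omega
  · simp only [h, if_false, and_false] at this ⊢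
    omega

lemma sum_arrive_le (B : ℕ∞) (x : Config N) (n : Fin N) : ∑ j, arrive B x n j ≤ ∑ j, x j + 1 := by
  have := sum_update x n (if (x n : ℕ∞) < B then x n + 1 else x n)
  rw [arrive]
  split_ifs at * <;> omega

lemma arrive_le {B : ℕ∞} {x : Config N} (h : ∀ j, (x j : ℕ∞) ≤ B) (n j : Fin N) :
    (arrive B x n j : ℕ∞) ≤ B := by
  rw [arrive, Function.update_apply]
  split_ifs with h1 h2
  · exact_mod_cast Order.add_one_le_of_lt h2
  · exact h _
  · exact h _

/-! ### The comparison of two configurations -/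

/-- The configuration `x` is at least as balanced as `y`, and the difference is controlled by the
parameter `r` and the number `e` of failures. -/
structure MoreBalanced (B : ℕ∞) (r : ℕ) (x y : Config N) (e : ℕ) : Prop where
  left_le : ∀ j, (x j : ℕ∞) ≤ B
  right_le : ∀ j, (y j : ℕ∞) ≤ B
  lower : ∀ k, load k y ≤ load k x
  upper : ∀ k, load k x ≤ load k y + k * r + e

lemma MoreBalanced.refl {B : ℕ∞} {x : Config N} (h : ∀ j, (x j : ℕ∞) ≤ B) (r : ℕ) :
    MoreBalanced B r x x 0 := ⟨h, h, fun _ => le_rfl, fun _ => by omega⟩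

lemma MoreBalanced.depart {B : ℕ∞} {r : ℕ} {x y : Config N} {e : ℕ} (h : MoreBalanced B r x y e) (u : ℕ) :
    MoreBalanced B r (depart x u) (depart y u) e := by
  refine ⟨fun j => le_trans (mod_cast depart_le x u j) (h.left_le j),
    fun j => le_trans (mod_cast depart_le y u j) (h.right_le j), fun k => ?_, fun k => ?_⟩
  all_goals
    have hx := load_depart k x u
    have hy := load_depart k y u
    have rx := tasksInSmallPools_add k x
    have ry := tasksInSmallPools_add k y
    have l0 := h.lower k
    have u0 := h.upper k
  · have l1 := Nat.mul_le_mul_left k (h.lower (k + 1))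
    by_contra hlt
    -- Loads drop by at most one, so the inequality can only break from equality. Then the bound at
    -- k + 1 makes the threshold of x at most that of y.
    have heq : load k x = load k y := by split_ifs at hx hy <;> omega
    have : ¬ tasksInSmallPools k y < tasksInSmallPools k x := by rw [heq] at rx; omega
    split_ifs at hx hy <;> omega
  · have u1 := Nat.mul_le_mul_left k (h.upper (k + 1))
    by_contra hlt
    -- Again only equality is critical. With slack c(k) = k r + e one has (k + 1) c(k) - k c(k + 1)
    -- = e ≥ 0, so the threshold of x is at least that of y.
    have heq : load k x = load k y + k * r + e := by split_ifs at hx hy <;> omega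
    have : tasksInSmallPools k y ≤ tasksInSmallPools k x := by
      rw [heq] at rx
      nlinarith
    split_ifs at hx hy <;> omega

/-- A pool j with y j ≥ y m has min (x j) k ≤ min (y j) k; each of the remaining pools costs at most
k. -/
lemma load_le_of_min_le {x y : Config N} {m : Fin N} {k : ℕ} (h : ∀ j, min (x j) k ≤ y m) :
    load k x ≤ load k y + k * poolsBelow y m := by
  rw [load, load, poolsBelow, Finset.card_filter, Finset.mul_sum, ← Finset.sum_add_distrib]
  refine Finset.sum_le_sum fun j _ => ?_
  have := h j
  have := min_le_right (x j) k
  split_ifs <;> omega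

lemma MoreBalanced.arrive {B : ℕ∞} {r : ℕ} {x y : Config N} {e : ℕ} (h : MoreBalanced B r x y e)
    {n : Fin N} (hn : ∀ j, x n ≤ x j) (m : Fin N) :
    MoreBalanced B r (arrive B x n) (arrive B y m) (e + if r ≤ poolsBelow y m then 1 else 0) := by
  refine ⟨fun j => arrive_le h.left_le n j, fun j => arrive_le h.right_le m j, fun k => ?_,
    fun k => ?_⟩
  · rw [load_arrive B k x n]
    split_ifs with hx
    · have := h.lower k
      rw [load_arrive]
      split_ifs <;> omega
    -- `load k x` fails to grow only if the least loaded pool of x has k tasks or is full. Then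
    -- every pool of x does or is, and x dominates y pool by pool up to height k.
    · rw [add_zero]
      refine Finset.sum_le_sum fun j _ => ?_
      rw [not_and_or, not_lt, not_lt] at hx
      obtain hx | hx := hx
      · have := hn j
        omega
      · refine min_le_min ?_ le_rfl
        have h1 : (_root_.arrive B y m j : ℕ∞) ≤ x n := (arrive_le h.right_le m j).trans hx
        exact (Nat.cast_le.1 h1).trans (hn j)
  · have hu := h.upper k
    rw [load_arrive B k y m]
    by_cases hx : x n < k ∧ (x n : ℕ∞) < B
    · have hx' : load k (_root_.arrive B x n) = load k x + 1 := by rw [load_arrive, if_pos hx]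
      by_cases hy : y m < k ∧ (y m : ℕ∞) < B
      · rw [hx', if_pos hy]; omega
      · by_cases hf : r ≤ poolsBelow y m
        · rw [hx', if_neg hy, if_pos hf]; omega
        · rw [not_and_or, not_lt, not_lt] at hy
          -- Here m has at least k tasks or is full, so no pool of the new x, cut at k, exceeds y m.
          -- As fewer than r pools lie below m, the upper bound holds without recourse to the old
          -- one.
          have := load_le_of_min_le (x := _root_.arrive B x n) (y := y) (m := m) (k := k)
            fun j => by
              obtain hy | hy := hy
              · exact (min_le_right _ _).trans hy
              · exact (min_le_left _ _).trans
                  (Nat.cast_le.1 ((arrive_le h.left_le n j).trans hy))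
          have hr := Nat.mul_le_mul_left k (not_le.1 hf).le
          omega
    · have hx' : load k (_root_.arrive B x n) = load k x := by rw [load_arrive, if_neg hx, add_zero]
      rw [hx']
      omega

lemma MoreBalanced.abs_occupancy_sub_le {B : ℕ∞} {r : ℕ} {x y : Config N} {e : ℕ}
    (h : MoreBalanced B r x y e) {i : ℕ} (hi : 1 ≤ i) :
    |(occupancy i x : ℝ) - occupancy i y| ≤ i * r + e := by
  obtain ⟨k, rfl⟩ := Nat.exists_eq_add_of_le' hi
  have hx := load_succ k x
  have hy := load_succ k y
  have l0 := h.lower k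
  have u0 := h.upper k
  have l1 := h.lower (k + 1)
  have u1 := h.upper (k + 1)
  have hk : k * r ≤ (k + 1) * r := Nat.mul_le_mul_right _ k.le_succ
  have a1 : occupancy (k + 1) x ≤ occupancy (k + 1) y + ((k + 1) * r + e) := by omega
  have a2 : occupancy (k + 1) y ≤ occupancy (k + 1) x + ((k + 1) * r + e) := by omega
  have b1 : (occupancy (k + 1) x : ℝ) ≤ occupancy (k + 1) y + (((k + 1 : ℕ) : ℝ) * r + e) := by
    exact_mod_cast a1
  have b2 : (occupancy (k + 1) y : ℝ) ≤ occupancy (k + 1) x + (((k + 1 : ℕ) : ℝ) * r + e) := by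
    exact_mod_cast a2
  rw [abs_sub_le_iff]
  constructor <;> linarith

end Configuration

/-! ### Sampling of pools -/

section Sampling

variable {N d : ℕ}

/-- Factor by factor, (a - j) / (N - j) ≤ a / N: sampling without replacement misses a set no more
often than sampling with replacement. -/
lemma descFactorial_mul_pow_le {a N : ℕ} (h : a ≤ N) (d : ℕ) :
    a.descFactorial d * N ^ d ≤ N.descFactorial d * a ^ d := by
  induction d with
  | zero => simp
  | succ d ih =>
    have h1 : (a - d) * N ≤ (N - d) * a := by
      rw [Nat.sub_mul, Nat.sub_mul, mul_comm N a]
      exact Nat.sub_le_sub_left (Nat.mul_le_mul_left d h) _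
    calc _ = ((a - d) * N) * (a.descFactorial d * N ^ d) := by
          rw [Nat.descFactorial_succ]; ring
      _ ≤ ((N - d) * a) * (N.descFactorial d * a ^ d) := Nat.mul_le_mul h1 ih
      _ = _ := by rw [Nat.descFactorial_succ]; ring

lemma sum_sampleProb_disjoint_withoutReplacement (L : Finset (Fin N)) :
    ∑ S, (if Disjoint S L then sampleProb N d .withoutReplacement S else 0)
      = ((N - L.card).choose d : ℝ≥0) / N.choose d := by
  have h : ∀ S : Finset (Fin N), (if Disjoint S L then sampleProb N d .withoutReplacement S else 0)
      = if S ∈ Finset.powersetCard d Lᶜ then ((N.choose d : ℕ) : ℝ≥0)⁻¹ else 0 := by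
    intro S
    simp only [sampleProb, Finset.mem_powersetCard, Finset.subset_compl_iff_disjoint_right]
    by_cases h1 : Disjoint S L <;> by_cases h2 : S.card = d <;> simp [h1, h2]
  simp only [h, Finset.sum_ite_mem, Finset.univ_inter, Finset.sum_const, Finset.card_powersetCard,
    Finset.card_compl, Fintype.card_fin, nsmul_eq_mul, div_eq_mul_inv]

lemma sum_sampleProb_disjoint_withReplacement (L : Finset (Fin N)) :
    ∑ S, (if Disjoint S L then sampleProb N d .withReplacement S else 0)
      = ((N - L.card : ℕ) : ℝ≥0) ^ d / (N : ℝ≥0) ^ d := by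
  have h1 : (Finset.univ.filter fun v : Fin d → Fin N => ∀ i, v i ∈ Lᶜ).card
      = (N - L.card) ^ d := by
    have : (Finset.univ.filter fun v : Fin d → Fin N => ∀ i, v i ∈ Lᶜ)
        = Fintype.piFinset fun _ => Lᶜ := by
      ext v; simp
    rw [this, Fintype.card_piFinset]
    simp [Finset.card_compl]
  have h2 : ∑ S, (if Disjoint S L then
        (Finset.univ.filter fun v : Fin d → Fin N => Finset.univ.image v = S).card else 0)
      = (N - L.card) ^ d := by
    rw [← h1, Finset.card_eq_sum_card_fiberwise (f := fun v : Fin d → Fin N => Finset.univ.image v)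
      (t := Finset.univ) (fun _ _ => Finset.mem_coe.2 (Finset.mem_univ _))]
    refine Finset.sum_congr rfl fun S _ => ?_
    rw [Finset.filter_filter]
    split_ifs with hS
    · congr 1
      ext v
      simp only [Finset.mem_filter, Finset.mem_univ, true_and, iff_and_self, Finset.mem_compl]
      rintro rfl i
      exact Finset.disjoint_left.1 hS (Finset.mem_image_of_mem _ (Finset.mem_univ i))
    · rw [eq_comm, Finset.card_eq_zero, Finset.filter_eq_empty_iff]
      rintro v - ⟨hv, rfl⟩
      refine hS (Finset.disjoint_left.2 fun j hj => ?_)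
      obtain ⟨i, -, rfl⟩ := Finset.mem_image.1 hj
      exact Finset.mem_compl.1 (hv i)
  rw [← Nat.cast_pow, ← h2, Nat.cast_sum, Finset.sum_div]
  refine Finset.sum_congr rfl fun S _ => ?_
  split_ifs <;> simp [sampleProb]

lemma sum_sampleProb (hd : 1 ≤ d) (hdN : d ≤ N) (m : Sampling) : ∑ S, sampleProb N d m S = 1 := by
  have hN : (N : ℝ≥0) ≠ 0 := by simp; omega
  cases m with
  | withoutReplacement =>
    have h := sum_sampleProb_disjoint_withoutReplacement (d := d) (∅ : Finset (Fin N))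
    have hc : (N.choose d : ℝ≥0) ≠ 0 := by simpa using (Nat.choose_pos hdN).ne'
    simpa [div_self hc] using h
  | withReplacement =>
    have h := sum_sampleProb_disjoint_withReplacement (d := d) (∅ : Finset (Fin N))
    simpa [div_self (pow_ne_zero d hN)] using h

lemma nonempty_of_sampleProb_ne_zero (hd : 1 ≤ d) {m : Sampling} {S : Finset (Fin N)}
    (h : sampleProb N d m S ≠ 0) : S.Nonempty := by
  rw [Finset.nonempty_iff_ne_empty]
  rintro rfl
  cases m with
  | withoutReplacement => exact h (by rw [sampleProb, Finset.card_empty, if_neg (by omega)])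
  | withReplacement =>
    have : Nonempty (Fin d) := ⟨⟨0, hd⟩⟩
    exact h (by simp [sampleProb, Finset.univ_eq_empty_iff])

/-- The probability that none of the pools in a set of `r` or more pools is inspected. -/
lemma sum_sampleProb_disjoint_le (hdN : d ≤ N) (m : Sampling) {L : Finset (Fin N)} {r : ℕ}
    (hr : r ≤ L.card) :
    ((∑ S, (if Disjoint S L then sampleProb N d m S else 0) : ℝ≥0) : ℝ)
      ≤ Real.exp (-(d * (r / N))) := by
  obtain rfl | hN := Nat.eq_zero_or_pos N
  · obtain rfl : d = 0 := by omega
    cases m with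
    | withoutReplacement => rw [sum_sampleProb_disjoint_withoutReplacement]; simp
    | withReplacement => rw [sum_sampleProb_disjoint_withReplacement]; simp
  have hN' : (0 : ℝ) < N := by exact_mod_cast hN
  have hL : L.card ≤ N := by simpa using L.card_le_univ
  have h1 : (((N - L.card : ℕ) : ℝ) / N) ^ d ≤ Real.exp (-(d * (r / N))) := by
    have h2 : ((N - L.card : ℕ) : ℝ) / N ≤ Real.exp (-(r / N)) := by
      refine le_trans ?_ (Real.one_sub_le_exp_neg _)
      rw [Nat.cast_sub hL, sub_div, div_self hN'.ne']
      gcongr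
    calc _ ≤ Real.exp (-(r / N)) ^ d := by gcongr
      _ = _ := by rw [← Real.exp_nat_mul]; ring_nf
  refine le_trans ?_ h1
  cases m with
  | withoutReplacement =>
    rw [sum_sampleProb_disjoint_withoutReplacement, div_pow]
    push_cast
    have hc : (0 : ℝ) < N.choose d := by exact_mod_cast Nat.choose_pos hdN
    rw [div_le_div_iff₀ hc (by positivity)]
    have h := descFactorial_mul_pow_le (Nat.sub_le N L.card) d
    rw [Nat.descFactorial_eq_factorial_mul_choose, Nat.descFactorial_eq_factorial_mul_choose,
      mul_assoc, mul_assoc] at h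
    have h := Nat.le_of_mul_le_mul_left h d.factorial_pos
    rw [mul_comm (N.choose d)] at h
    exact_mod_cast h
  | withReplacement =>
    rw [sum_sampleProb_disjoint_withReplacement, div_pow, NNReal.coe_div, NNReal.coe_pow,
      NNReal.coe_pow, NNReal.coe_natCast, NNReal.coe_natCast]

lemma sum_jsqd (m : Sampling) (tie : ∀ N, TieRule N) {d : ℕ → ℕ} (hd : 1 ≤ d N) (hdN : d N ≤ N)
    (x : Config N) : ∑ n, jsqd m tie d N x n = 1 := by
  simp only [jsqd]
  rw [Finset.sum_comm, ← sum_sampleProb hd hdN m]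
  refine Finset.sum_congr rfl fun S _ => ?_
  rw [← Finset.mul_sum]
  by_cases h : sampleProb N (d N) m S = 0
  · simp [h]
  · rw [(tie N).sum_eq_one x S (nonempty_of_sampleProb_ne_zero hd h), mul_one]

lemma le_of_jsq_ne_zero {tie : ∀ N, TieRule N} {x : Config N} {n : Fin N}
    (h : jsq tie N x n ≠ 0) (j : Fin N) : x n ≤ x j := by
  have h' : ∑ S, sampleProb N N .withoutReplacement S * (tie N).prob x S n ≠ 0 := h
  obtain ⟨S, -, hS⟩ := Finset.exists_ne_zero_of_sum_ne_zero h'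
  have h1 := left_ne_zero_of_mul hS
  have h2 := right_ne_zero_of_mul hS
  refine ((tie N).isMin x S n h2).2 j ?_
  have hc : S.card = N := by
    by_contra hc
    simp [sampleProb, hc] at h1
  rw [(Finset.card_eq_iff_eq_univ S).1 (by simpa using hc)]
  exact Finset.mem_univ j

lemma TieRule.sum_le_one (tie : TieRule N) (x : Config N) (S : Finset (Fin N)) :
    ∑ n, tie.prob x S n ≤ 1 := by
  obtain rfl | hS := S.eq_empty_or_nonempty
  · refine (Finset.sum_eq_zero fun n _ => ?_).trans_le zero_le_one
    by_contra h
    simpa using (tie.isMin x ∅ n h).1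
  · exact (tie.sum_eq_one x S hS).le

/-- The probability that JSQ(`d`) directs a task to a pool such that at least `r` pools have fewer
tasks. -/
lemma sum_jsqd_poolsBelow_le (m : Sampling) (tie : ∀ N, TieRule N) {d : ℕ → ℕ} (hdN : d N ≤ N)
    (x : Config N) (r : ℕ) :
    ((∑ n, (if r ≤ poolsBelow x n then jsqd m tie d N x n else 0) : ℝ≥0) : ℝ)
      ≤ Real.exp (-(d N * (r / N))) := by
  by_cases hF : (Finset.univ.filter fun n => r ≤ poolsBelow x n).Nonempty
  · obtain ⟨n₀, hn₀, hmin⟩ := Finset.exists_min_image _ x hF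
    simp only [Finset.mem_filter, Finset.mem_univ, true_and] at hn₀ hmin
    refine le_trans (NNReal.coe_le_coe.2 ?_) (sum_sampleProb_disjoint_le hdN m hn₀)
    calc _ ≤ ∑ n, ∑ S, (if Disjoint S (Finset.univ.filter fun j => x j < x n₀) then
          sampleProb N (d N) m S else 0) * (tie N).prob x S n := by
          refine Finset.sum_le_sum fun n _ => ?_
          split_ifs with hn
          · refine Finset.sum_le_sum fun S _ => ?_
            split_ifs with hS
            · exact le_rfl
            · refine le_of_eq (mul_eq_zero_of_right _ ?_) |>.trans zero_le
              by_contra hp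
              refine hS (Finset.disjoint_left.2 fun j hj hj' => ?_)
              have h1 := ((tie N).isMin x S n hp).2 j hj
              have h2 := hmin n hn
              simp at hj'
              omega
          · exact zero_le
      _ ≤ _ := by
          rw [Finset.sum_comm]
          refine Finset.sum_le_sum fun S _ => ?_
          rw [← Finset.mul_sum]
          exact mul_le_of_le_one_right zero_le ((tie N).sum_le_one x S)
  · rw [Finset.not_nonempty_iff_eq_empty, Finset.filter_eq_empty_iff] at hF
    rw [Finset.sum_eq_zero fun n hn => if_neg (hF hn)]
    exact (Real.exp_pos _).le

end Sampling

/-! ### Jump processes that are systems of server pools -/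

section System

variable {N : ℕ}

lemma exists_forall_abs_le_of_finite_support {α : Type*} {f : α → ℝ} (hf : f.support.Finite) :
    ∃ C, ∀ x, |f x| ≤ C := by
  obtain ⟨C, hC⟩ := (hf.image fun x => |f x|).bddAbove
  refine ⟨max C 0, fun x => ?_⟩
  by_cases hx : f x = 0
  · simp [hx]
  · exact (hC (Set.mem_image_of_mem _ hx)).trans (le_max_left _ _)

/-- A transition changes the number of tasks by at most one, so the generator vanishes at
configurations with more than M + 1 tasks if f vanishes above M. This supplies the bound on the
generator needed for Dynkin's martingale. -/
lemma finite_support_generator (B : ℕ∞) (lam : ℝ≥0) (a : Config N → Fin N → ℝ≥0)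
    {f : Config N → ℝ} (hf : f.support.Finite) : (generator B lam a f).support.Finite := by
  obtain ⟨M, hM⟩ := (hf.image fun x => ∑ n, x n).bddAbove
  have hM' : ∀ x, M < ∑ n, x n → f x = 0 := fun x hx => by
    by_contra h
    exact hx.not_ge (hM (Set.mem_image_of_mem _ h))
  refine (Set.finite_Iic (fun _ : Fin N => M + 1)).subset fun x hx n => ?_
  refine le_trans (Finset.single_le_sum (f := x) (fun _ _ => Nat.zero_le _) (Finset.mem_univ n)) ?_
  by_contra hlt
  replace hlt : M + 1 < ∑ n, x n := not_le.1 hlt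
  refine hx ?_
  have h0 : f x = 0 := hM' x (by omega)
  have hu : ∀ n v, x n ≤ v + 1 → f (Function.update x n v) = 0 := fun n v hv => hM' _ (by
    have := sum_update x n v
    omega)
  rw [generator, Finset.sum_eq_zero, Finset.sum_eq_zero, add_zero]
  · intro n _
    rw [hu n _ (by omega), h0]; simp
  · intro n _
    rw [hu n _ (by omega), h0]; simp

lemma sum_range_getElem?_elim {α : Type*} (g : α → ℝ) (l : List α) {M : ℕ} (hM : l.length ≤ M) :
    ∑ u ∈ Finset.range M, (l[u]?).elim 0 g = (l.map g).sum := by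
  induction l generalizing M with
  | nil => simp
  | cons b l ih =>
    obtain ⟨M, rfl⟩ := Nat.exists_eq_add_of_lt (lt_of_lt_of_le (Nat.succ_pos l.length) hM)
    rw [zero_add, Finset.sum_range_succ']
    simp only [List.length_cons] at hM
    simp [ih (show l.length ≤ M by omega), add_comm]

lemma sum_range_depart (f : Config N → ℝ) (x : Config N) {M : ℕ} (hM : ∑ n, x n ≤ M) :
    ∑ u ∈ Finset.range M, (f (depart x u) - f x)
      = ∑ n, (x n : ℝ) * (f (Function.update x n (x n - 1)) - f x) := by
  have := sum_map_taskList x fun n => f (complete x n) - f x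
  rw [← sum_range_getElem?_elim _ _ ((length_taskList x).trans_le hM)] at this
  simp only [nsmul_eq_mul, complete] at this
  rw [← this]
  refine Finset.sum_congr rfl fun u _ => ?_
  rw [depart]
  cases (taskList x)[u]? with
  | none => simp
  | some n => simp [complete]

/-- Discarded arrivals and positions beyond the end of the task list leave x unchanged and
contribute 0. Hence M may exceed the number of tasks, and two systems can share one range of
positions. -/
lemma generator_eq_sum_arrive (B : ℕ∞) (lam : ℝ≥0) (a : Config N → Fin N → ℝ≥0)
    (f : Config N → ℝ) (x : Config N) {M : ℕ} (hM : ∑ n, x n ≤ M) :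
    generator B lam a f x = ∑ n, (lam : ℝ) * a x n * (f (arrive B x n) - f x)
      + ∑ u ∈ Finset.range M, (f (depart x u) - f x) := by
  rw [generator, sum_range_depart f x hM]
  congr 1
  refine Finset.sum_congr rfl fun n _ => ?_
  rw [arrive]
  split_ifs <;> simp

variable {E : Type*} [MeasurableSpace E] [Countable E] [MeasurableSingletonClass E]
  {Ω : Type*} {mΩ : MeasurableSpace Ω} {R : E → Measure E} [IsJumpRate R] {P : Measure Ω}
  [IsProbabilityMeasure P] {G : Filtration ℕ mΩ} {Z₀ : Ω → E} {ξ : ℕ → Ω → ℝ × (E → E)}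

/-- A function of a jump process is a system if the generators match. -/
lemma IsJumpNoise.isSystem (hξ : IsJumpNoise R P G Z₀ ξ) (hne : IsNonexplosive R Z₀ ξ P)
    {B : ℕ∞} {lam : ℝ≥0} {a : Config N → Fin N → ℝ≥0} {p : E → Config N}
    (hgen : ∀ f z, jumpGenerator R (fun z => f (p z)) z = generator B lam a f (p z)) :
    IsSystem B lam a (P.map fun ω => p (Z₀ ω)) P fun t ω => p (jumpProcess R Z₀ ξ t ω) := by
  have hp : Measurable p := .of_discrete
  refine ⟨fun t => hp.comp (hξ.measurable_jumpProcess t), ?_, ?_, jumpFiltration R Z₀ ξ G,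
    fun t => hp.comp (hξ.measurable_jumpProcess_jumpFiltration t), fun f hf => ?_⟩
  · filter_upwards [hne] with ω h t
    refine ⟨(jumpProcess_rightContinuous h t).mono fun s hs => by rw [hs], ?_⟩
    obtain ⟨z, hz⟩ := jumpProcess_leftLimit h t
    exact ⟨p z, hz.mono fun s hs => by rw [hs]⟩
  · refine Measure.map_congr ?_
    filter_upwards [hξ.ae_clock_pos] with ω h
    rw [jumpProcess_zero_of_pos h]
  · obtain ⟨C, hC⟩ := exists_forall_abs_le_of_finite_support hf
    obtain ⟨D, hD⟩ := exists_forall_abs_le_of_finite_support (finite_support_generator B lam a hf)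
    have := hξ.martingale_dynkinProcess (f := fun z => f (p z)) hne (fun z => hC (p z))
      (fun z => (hgen f z).symm ▸ hD (p z))
    convert! this using 3 with t ω
    rw [dynkinProcess]
    simp only [hgen]

/-- Expectation of Dynkin's martingale, which starts at 0. -/
lemma IsJumpNoise.integral_jumpProcess_le (hξ : IsJumpNoise R P G Z₀ ξ)
    (hne : IsNonexplosive R Z₀ ξ P) {f : E → ℝ} {C D : ℝ} (hC : ∀ z, |f z| ≤ C)
    (hD : ∀ z, |jumpGenerator R f z| ≤ D) (h0 : ∀ ω, f (Z₀ ω) = 0) (t : ℝ≥0) :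
    ∫ ω, f (jumpProcess R Z₀ ξ t ω) ∂P ≤ D * t := by
  have hf : Measurable f := .of_discrete
  have h1 : ∫ ω, dynkinProcess R Z₀ ξ f t ω ∂P = 0 := by
    have hm := (hξ.martingale_dynkinProcess hne hC hD).setIntegral_eq (zero_le : 0 ≤ t)
      MeasurableSet.univ
    rw [setIntegral_univ, setIntegral_univ] at hm
    rw [← hm]
    refine integral_eq_zero_of_ae ?_
    filter_upwards [hξ.ae_clock_pos] with ω h
    simp [dynkinProcess, jumpProcess_zero_of_pos h, h0]
  have hi : Integrable (fun ω => f (jumpProcess R Z₀ ξ t ω)) P :=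
    Integrable.of_bound (hf.comp (hξ.measurable_jumpProcess t)).aestronglyMeasurable C
      (ae_of_all _ fun ω => hC _)
  have h2 : ∫ ω, (f (jumpProcess R Z₀ ξ t ω) - D * t) ∂P ≤ ∫ ω, dynkinProcess R Z₀ ξ f t ω ∂P := by
    refine integral_mono (hi.sub (integrable_const _)) (hξ.integrable_dynkinProcess hC hD t)
      fun ω => ?_
    refine sub_le_sub_left ?_ _
    have := intervalIntegral.norm_integral_le_of_norm_le_const (a := 0) (b := (t : ℝ))
      (f := fun s => jumpGenerator R f (jumpProcess R Z₀ ξ s.toNNReal ω)) (C := D)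
      fun s _ => hD _
    rw [sub_zero, abs_of_nonneg t.coe_nonneg] at this
    exact (le_abs_self _).trans this
  rw [integral_sub hi (integrable_const _), h1] at h2
  simpa using h2

end System

/-! ### The coupling -/

section Coupling

variable {N : ℕ}

/-- The rates of the coupling of two systems. A state consists of the two configurations and of the
number of arrivals that, in the second system, were directed to a pool with `r` or more pools below.
The arriving tasks are the same for both systems and are directed independently. The tasks of both
systems are sorted by the number of tasks in their pools, and tasks at the same position of the two
lists are completed simultaneously. -/
noncomputable def couplingRate (B : ℕ∞) (lam : ℝ≥0) (a₁ a₂ : Config N → Fin N → ℝ≥0) (r : ℕ)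
    (z : Config N × Config N × ℕ) : Measure (Config N × Config N × ℕ) :=
  ∑ p : Fin N × Fin N, (lam * (a₁ z.1 p.1 * a₂ z.2.1 p.2)) •
      Measure.dirac (arrive B z.1 p.1, arrive B z.2.1 p.2,
        z.2.2 + if r ≤ poolsBelow z.2.1 p.2 then 1 else 0)
    + ∑ u ∈ Finset.range (max (∑ n, z.1 n) (∑ n, z.2.1 n)),
        Measure.dirac (depart z.1 u, depart z.2.1 u, z.2.2)
    + Measure.dirac z

variable {B : ℕ∞} {lam : ℝ≥0} {a₁ a₂ : Config N → Fin N → ℝ≥0} {r : ℕ}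

/-- The term `Measure.dirac z` is a void jump of rate 1. It keeps the total rate positive, even for
an empty system without arrivals, and does not affect the generator. -/
instance : IsJumpRate (couplingRate B lam a₁ a₂ r) where
  isFinite z := by
    unfold couplingRate
    infer_instance
  ne_zero z h := by
    have := congrArg (fun m => m {z}) h
    simp [couplingRate] at this

lemma integral_couplingRate (g : Config N × Config N × ℕ → ℝ) (z : Config N × Config N × ℕ) :
    ∫ z', g z' ∂(couplingRate B lam a₁ a₂ r z)
      = ∑ n, ∑ m, (lam : ℝ) * (a₁ z.1 n * a₂ z.2.1 m) * g (arrive B z.1 n, arrive B z.2.1 m,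
          z.2.2 + if r ≤ poolsBelow z.2.1 m then 1 else 0)
        + ∑ u ∈ Finset.range (max (∑ n, z.1 n) (∑ n, z.2.1 n)),
            g (depart z.1 u, depart z.2.1 u, z.2.2)
        + g z := by
  have hi : ∀ z', Integrable g (Measure.dirac z') := fun z' => integrable_dirac (by simp)
  have h1 : Integrable g (∑ p : Fin N × Fin N, (lam * (a₁ z.1 p.1 * a₂ z.2.1 p.2)) •
      Measure.dirac (arrive B z.1 p.1, arrive B z.2.1 p.2,
        z.2.2 + if r ≤ poolsBelow z.2.1 p.2 then 1 else 0)) :=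
    integrable_finsetSum_measure.2 fun p _ => (hi _).smul_measure_nnreal
  have h2 : Integrable g (∑ u ∈ Finset.range (max (∑ n, z.1 n) (∑ n, z.2.1 n)),
        Measure.dirac (depart z.1 u, depart z.2.1 u, z.2.2)) :=
    integrable_finsetSum_measure.2 fun u _ => hi _
  rw [couplingRate, integral_add_measure (h1.add_measure h2) (hi _), integral_add_measure h1 h2,
    integral_finsetSum_measure fun p _ => (hi _).smul_measure_nnreal,
    integral_finsetSum_measure fun u _ => hi _, Fintype.sum_prod_type]
  simp [integral_smul_nnreal_measure, NNReal.smul_def]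

/-- Arrivals of zero rate are null. The premise `a₁ z.1 n ≠ 0` is how the minimality of the pool
chosen by JSQ enters. -/
lemma ae_couplingRate {Q : Config N × Config N × ℕ → Prop} {z : Config N × Config N × ℕ}
    (h1 : ∀ n m, a₁ z.1 n ≠ 0 → Q (arrive B z.1 n, arrive B z.2.1 m,
      z.2.2 + if r ≤ poolsBelow z.2.1 m then 1 else 0))
    (h2 : ∀ u, Q (depart z.1 u, depart z.2.1 u, z.2.2)) (h3 : Q z) :
    ∀ᵐ z' ∂(couplingRate B lam a₁ a₂ r z), Q z' := by
  rw [couplingRate, ae_add_measure_iff, ae_add_measure_iff]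
  refine ⟨⟨?_, ?_⟩, ?_⟩
  · rw [ae_finsetSum_measure_iff]
    intro p _
    by_cases h : a₁ z.1 p.1 = 0
    · simp [h]
    · exact Measure.ae_smul_measure (by simpa using h1 _ _ h) _
  · rw [ae_finsetSum_measure_iff]
    intro u _
    simpa using h2 u
  · simpa using h3

/-- Summing out the destination in the other system leaves the marginal rates. The dummy `Fin N`
argument exempts N = 0, where the empty sum is not 1. -/
lemma jumpGenerator_couplingRate_fst (h₂ : ∀ x (_ : Fin N), ∑ n, a₂ x n = 1) (f : Config N → ℝ)
    (z : Config N × Config N × ℕ) :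
    jumpGenerator (couplingRate B lam a₁ a₂ r) (fun z => f z.1) z
      = generator B lam a₁ f z.1 := by
  rw [jumpGenerator, integral_couplingRate (fun z' => f z'.1 - f z.1),
    generator_eq_sum_arrive B lam a₁ f z.1 (le_max_left _ (∑ n, z.2.1 n)), sub_self, add_zero]
  congr 1
  refine Finset.sum_congr rfl fun n _ => ?_
  have : (∑ m, (a₂ z.2.1 m : ℝ)) = 1 := by exact_mod_cast congrArg NNReal.toReal (h₂ z.2.1 n)
  dsimp only
  rw [← Finset.sum_mul, ← Finset.mul_sum, ← Finset.mul_sum, this, mul_one]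

lemma jumpGenerator_couplingRate_snd (h₁ : ∀ x (_ : Fin N), ∑ n, a₁ x n = 1) (f : Config N → ℝ)
    (z : Config N × Config N × ℕ) :
    jumpGenerator (couplingRate B lam a₁ a₂ r) (fun z => f z.2.1) z
      = generator B lam a₂ f z.2.1 := by
  rw [jumpGenerator, integral_couplingRate (fun z' => f z'.2.1 - f z.2.1),
    generator_eq_sum_arrive B lam a₂ f z.2.1 (le_max_right (∑ n, z.1 n) _), sub_self, add_zero]
  congr 1
  rw [Finset.sum_comm]
  refine Finset.sum_congr rfl fun m _ => ?_
  have : (∑ n, (a₁ z.1 n : ℝ)) = 1 := by exact_mod_cast congrArg NNReal.toReal (h₁ z.1 m)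
  dsimp only
  rw [← Finset.sum_mul, ← Finset.mul_sum, ← Finset.sum_mul, this, one_mul]

/-- The rate of failures in the coupling. -/
lemma abs_jumpGenerator_couplingRate_le (h₁ : ∀ x (_ : Fin N), ∑ n, a₁ x n = 1) {q : ℝ}
    (hq : ∀ x, ((∑ n, (if r ≤ poolsBelow x n then a₂ x n else 0) : ℝ≥0) : ℝ) ≤ q) (K : ℕ)
    (z : Config N × Config N × ℕ) :
    |jumpGenerator (couplingRate B lam a₁ a₂ r) (fun z => ((min z.2.2 K : ℕ) : ℝ)) z|
      ≤ lam * q := by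
  rw [jumpGenerator, integral_couplingRate
    (fun z' => ((min z'.2.2 K : ℕ) : ℝ) - ((min z.2.2 K : ℕ) : ℝ))]
  simp only [sub_self, Finset.sum_const_zero, add_zero]
  have h0 : ∀ m : Fin N, 0 ≤ ((min (z.2.2 + if r ≤ poolsBelow z.2.1 m then 1 else 0) K : ℕ) : ℝ)
      - ((min z.2.2 K : ℕ) : ℝ) := fun m =>
    sub_nonneg.2 (Nat.cast_le.2 (min_le_min (Nat.le_add_right _ _) le_rfl))
  rw [abs_of_nonneg (Finset.sum_nonneg fun n _ => Finset.sum_nonneg fun m _ =>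
    mul_nonneg (by positivity) (h0 m))]
  refine le_trans ?_ (mul_le_mul_of_nonneg_left (hq z.2.1) lam.coe_nonneg)
  rw [Finset.sum_comm]
  push_cast
  rw [Finset.mul_sum]
  refine Finset.sum_le_sum fun m _ => ?_
  have : (∑ n, (a₁ z.1 n : ℝ)) = 1 := by exact_mod_cast congrArg NNReal.toReal (h₁ z.1 m)
  rw [← Finset.sum_mul, ← Finset.mul_sum, ← Finset.sum_mul, this, one_mul, mul_assoc]
  refine mul_le_mul_of_nonneg_left ?_ lam.coe_nonneg
  split_ifs with h
  · refine mul_le_of_le_one_right (a₂ z.2.1 m).coe_nonneg ?_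
    rw [sub_le_iff_le_add]
    have : min (z.2.2 + 1) K ≤ 1 + min z.2.2 K := by omega
    exact_mod_cast this
  · simp

lemma totalRate_couplingRate_le (h₁ : ∀ x (_ : Fin N), ∑ n, a₁ x n = 1)
    (h₂ : ∀ x (_ : Fin N), ∑ n, a₂ x n = 1) (z : Config N × Config N × ℕ) :
    totalRate (couplingRate B lam a₁ a₂ r) z
      ≤ (lam + 1 : ℝ) * ((max (∑ n, z.1 n) (∑ n, z.2.1 n) : ℕ) + 1) := by
  have h : totalRate (couplingRate B lam a₁ a₂ r) z
      = ∫ _, (1 : ℝ) ∂(couplingRate B lam a₁ a₂ r z) := by simp [totalRate]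
  have hs : ∑ n, ∑ m, (lam : ℝ) * (a₁ z.1 n * a₂ z.2.1 m) * 1 ≤ lam := by
    rcases isEmpty_or_nonempty (Fin N) with hN | ⟨⟨i⟩⟩
    · simp
    · have e1 : (∑ n, (a₁ z.1 n : ℝ)) = 1 := by exact_mod_cast congrArg NNReal.toReal (h₁ z.1 i)
      have e2 : (∑ n, (a₂ z.2.1 n : ℝ)) = 1 := by exact_mod_cast congrArg NNReal.toReal (h₂ z.2.1 i)
      simp only [mul_one, ← Finset.mul_sum, e1, e2, le_refl]
  rw [h, integral_couplingRate fun _ => 1]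
  rw [Finset.sum_const, Finset.card_range, nsmul_eq_mul, mul_one]
  generalize (max (∑ n, z.1 n) (∑ n, z.2.1 n) : ℕ) = M
  have : 0 ≤ (lam : ℝ) * M := by positivity
  linarith

lemma ae_couplingRate_size_le (z : Config N × Config N × ℕ) :
    ∀ᵐ z' ∂(couplingRate B lam a₁ a₂ r z),
      max (∑ n, z'.1 n) (∑ n, z'.2.1 n) ≤ max (∑ n, z.1 n) (∑ n, z.2.1 n) + 1 := by
  refine ae_couplingRate (fun n m _ => ?_) (fun u => ?_) (Nat.le_succ _)
  · have h1 := sum_arrive_le B z.1 n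
    have h2 := sum_arrive_le B z.2.1 m
    simp only
    omega
  · have h1 : ∑ n, depart z.1 u n ≤ ∑ n, z.1 n := Finset.sum_le_sum fun n _ => depart_le z.1 u n
    have h2 : ∑ n, depart z.2.1 u n ≤ ∑ n, z.2.1 n :=
      Finset.sum_le_sum fun n _ => depart_le z.2.1 u n
    simp only
    omega

lemma ae_couplingRate_moreBalanced (hmin : ∀ x n, a₁ x n ≠ 0 → ∀ j, x n ≤ x j)
    (z : Config N × Config N × ℕ) : ∀ᵐ z' ∂(couplingRate B lam a₁ a₂ r z),
      (MoreBalanced B r z.1 z.2.1 z.2.2 → MoreBalanced B r z'.1 z'.2.1 z'.2.2)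
        ∧ z.2.2 ≤ z'.2.2 :=
  ae_couplingRate (fun _ m hn => ⟨fun h => h.arrive (hmin _ _ hn) m, Nat.le_add_right _ _⟩)
    (fun u => ⟨fun h => h.depart u, le_rfl⟩) ⟨id, le_rfl⟩

/-- The coupling of JSQ with another scheme. -/
lemma IsJumpNoise.coupling {Ω : Type*} {mΩ : MeasurableSpace Ω} {P : Measure Ω}
    [IsProbabilityMeasure P] {G : Filtration ℕ mΩ} {x₀ : Ω → Config N}
    {ξ : ℕ → Ω → ℝ × (Config N × Config N × ℕ → Config N × Config N × ℕ)}
    (hξ : IsJumpNoise (couplingRate B lam a₁ a₂ r) P G (fun ω => (x₀ ω, x₀ ω, 0)) ξ)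
    (hx₀ : ∀ᵐ ω ∂P, ∀ n, (x₀ ω n : ℕ∞) ≤ B)
    (h₁ : ∀ x (_ : Fin N), ∑ n, a₁ x n = 1) (h₂ : ∀ x (_ : Fin N), ∑ n, a₂ x n = 1)
    (hmin : ∀ x n, a₁ x n ≠ 0 → ∀ j, x n ≤ x j) {q : ℝ}
    (hq : ∀ x, ((∑ n, (if r ≤ poolsBelow x n then a₂ x n else 0) : ℝ≥0) : ℝ) ≤ q) :
    ∃ X Y : ℝ≥0 → Ω → Config N,
      IsSystem B lam a₁ (P.map x₀) P X ∧ IsSystem B lam a₂ (P.map x₀) P Y ∧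
      (∀ᵐ ω ∂P, X 0 ω = Y 0 ω) ∧
      ∀ (T : ℝ≥0) (b : ℝ), 0 < b → ∃ A : Set Ω, P.real A ≤ lam * q * T / b ∧
        ∀ᵐ ω ∂P, ω ∉ A → ∀ t ≤ T, ∀ i : ℕ, 1 ≤ i →
          |(occupancy i (X t ω) : ℝ) - occupancy i (Y t ω)| ≤ i * r + b := by
  set R := couplingRate B lam a₁ a₂ r
  have hne : IsNonexplosive R (fun ω => (x₀ ω, x₀ ω, 0)) ξ P :=
    hξ.isNonexplosive (h := fun z => max (∑ n, z.1 n) (∑ n, z.2.1 n)) (by positivity)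
      (totalRate_couplingRate_le h₁ h₂) ae_couplingRate_size_le
  set Z := jumpProcess R (fun ω => (x₀ ω, x₀ ω, 0)) ξ
  refine ⟨fun t ω => (Z t ω).1, fun t ω => (Z t ω).2.1,
    hξ.isSystem hne (p := fun z => z.1) (jumpGenerator_couplingRate_fst h₂),
    hξ.isSystem hne (p := fun z => z.2.1) (jumpGenerator_couplingRate_snd h₁), ?_,
    fun T b hb => ⟨{ω | b ≤ (Z T ω).2.2}, ?_, ?_⟩⟩
  · filter_upwards [hξ.ae_clock_pos] with ω h
    simp only [Z, jumpProcess_zero_of_pos h]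
  -- The failure count is truncated at ⌈b⌉, since Dynkin's martingale needs a bounded function;
  -- reaching b is unaffected, and Markov's inequality applies at level b.
  · have hD := abs_jumpGenerator_couplingRate_le (B := B) (lam := lam) h₁ hq ⌈b⌉₊
    have h1 := hξ.integral_jumpProcess_le hne (f := fun z => ((min z.2.2 ⌈b⌉₊ : ℕ) : ℝ))
      (C := ⌈b⌉₊) (fun z => by
        rw [abs_of_nonneg (Nat.cast_nonneg _)]; exact Nat.cast_le.2 (min_le_right _ _)) hD
      (fun ω => by simp) T
    have hf : Measurable fun z : Config N × Config N × ℕ => ((min z.2.2 ⌈b⌉₊ : ℕ) : ℝ) :=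
      .of_discrete
    have h2 := mul_meas_ge_le_integral_of_nonneg (μ := P)
      (f := fun ω => ((min (Z T ω).2.2 ⌈b⌉₊ : ℕ) : ℝ)) (ae_of_all _ fun ω => Nat.cast_nonneg _)
      (Integrable.of_bound (hf.comp (hξ.measurable_jumpProcess T)).aestronglyMeasurable ⌈b⌉₊
        (ae_of_all _ fun ω => by
          rw [Real.norm_of_nonneg (Nat.cast_nonneg _)]; exact Nat.cast_le.2 (min_le_right _ _))) b
    rw [le_div_iff₀ hb, mul_comm]
    refine le_trans (mul_le_mul_of_nonneg_left (measureReal_mono fun ω hω => ?_) hb.le)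
      (h2.trans h1)
    simp only [Set.mem_ofPred_eq] at hω ⊢
    rw [Nat.cast_min]
    exact le_min hω (Nat.le_ceil b)
  · filter_upwards [hne, hξ.ae_jump (ae_couplingRate_moreBalanced hmin), hx₀]
      with ω hne hj hx hA t ht i hi
    have hb := jumpProcess_of_invariant (R := R) (ξ := ξ) (ω := ω)
      (Z₀ := fun ω => (x₀ ω, x₀ ω, 0)) (I := fun z => MoreBalanced B r z.1 z.2.1 z.2.2)
      (MoreBalanced.refl hx r) (fun k => (hj k).1) t
    have hm : (Z t ω).2.2 ≤ (Z T ω).2.2 :=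
      monotone_jumpProcess (F := fun z : Config N × Config N × ℕ => z.2.2) hne
        (fun k => (hj k).2) ht
    refine (hb.abs_occupancy_sub_le hi).trans (add_le_add le_rfl ?_)
    exact (Nat.cast_le.2 hm).trans (not_le.1 hA).le

end Coupling

/-! ### Alike schemes -/

section Alike

variable {B : ℕ∞} {lam : ℕ → ℝ≥0} {μ : ∀ N, Measure (Config N)} {tie₁ tie₂ : ∀ N, TieRule N}
  {m : Sampling} {d : ℕ → ℕ}

/-- The couplings of JSQ and JSQ(`d`) for all numbers of pools on a common probability space. -/
lemma exists_coupling (hμ : ∀ N, IsProbabilityMeasure (μ N))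
    (hμB : ∀ N, ∀ᵐ x ∂(μ N), ∀ n, (x n : ℕ∞) ≤ B) (hd : ∀ N, 1 ≤ N → 1 ≤ d N ∧ d N ≤ N)
    (r : ℕ → ℕ) :
    ∃ (Ω : Type) (_ : MeasurableSpace Ω) (P : Measure Ω) (_ : IsProbabilityMeasure P)
      (X Y : ∀ N, ℝ≥0 → Ω → Config N), ∀ N,
      IsSystem B (lam N) (jsq tie₁ N) (μ N) P (X N) ∧
      IsSystem B (lam N) (jsqd m tie₂ d N) (μ N) P (Y N) ∧
      (∀ᵐ ω ∂P, X N 0 ω = Y N 0 ω) ∧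
      ∀ (T : ℝ≥0) (b : ℝ), 0 < b → ∃ A : Set Ω,
        P.real A ≤ lam N * Real.exp (-(d N * (r N / N))) * T / b ∧
        ∀ᵐ ω ∂P, ω ∉ A → ∀ t ≤ T, ∀ i : ℕ, 1 ≤ i →
          |(occupancy i (X N t ω) : ℝ) - occupancy i (Y N t ω)| ≤ i * r N + b := by
  let E : ℕ → Type := fun N => Config N × Config N × ℕ
  let R : ∀ N, E N → Measure (E N) := fun N =>
    couplingRate B (lam N) (jsq tie₁ N) (jsqd m tie₂ d N) (r N)
  -- The coordinate `ω k N` belongs to the system with N pools: k = 0 supplies its initial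
  -- configuration and k + 1 the noise of its jump number k.
  let Λ : Measure (∀ N, Config N × (ℝ × (E N → E N))) :=
    Measure.infinitePi fun N => (μ N).prod (noiseLaw (R N))
  let P : Measure (ℕ → ∀ N, Config N × (ℝ × (E N → E N))) := Measure.infinitePi fun _ => Λ
  have heval : ∀ k N, MeasurePreserving
      (fun ω : ℕ → ∀ N, Config N × (ℝ × (E N → E N)) => ω k N) P ((μ N).prod (noiseLaw (R N))) :=
    fun k N => (measurePreserving_eval_infinitePi (fun N => (μ N).prod (noiseLaw (R N))) N).comp
      (measurePreserving_eval_infinitePi (fun _ : ℕ => Λ) k)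
  have hind : iIndepFun (fun k (ω : ℕ → ∀ N, Config N × (ℝ × (E N → E N))) => ω k) P :=
    iIndepFun_infinitePi (P := fun _ => Λ) (X := fun _ s => s) fun _ => measurable_id
  have key : ∀ N, ∃ X Y : ℝ≥0 → (ℕ → ∀ N, Config N × (ℝ × (E N → E N))) → Config N,
      IsSystem B (lam N) (jsq tie₁ N) (μ N) P X ∧
      IsSystem B (lam N) (jsqd m tie₂ d N) (μ N) P Y ∧
      (∀ᵐ ω ∂P, X 0 ω = Y 0 ω) ∧
      ∀ (T : ℝ≥0) (b : ℝ), 0 < b → ∃ A : Set (ℕ → ∀ N, Config N × (ℝ × (E N → E N))),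
        P.real A ≤ lam N * Real.exp (-(d N * (r N / N))) * T / b ∧
        ∀ᵐ ω ∂P, ω ∉ A → ∀ t ≤ T, ∀ i : ℕ, 1 ≤ i →
          |(occupancy i (X t ω) : ℝ) - occupancy i (Y t ω)| ≤ i * r N + b := by
    intro N
    have hx₀ := measurePreserving_fst.comp (heval 0 N)
    have hξ : IsJumpNoise (R N) P _ (fun ω => ((ω 0 N).1, (ω 0 N).1, 0))
        (fun k ω => (ω (k + 1) N).2) :=
      isJumpNoise_of_iIndepFun (fun k => measurable_pi_apply k) hind
        (φ := fun s => ((s N).1, (s N).1, 0)) (by fun_prop) (ψ := fun s => (s N).2) (by fun_prop)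
        fun k => (measurePreserving_snd.comp (heval (k + 1) N)).map_eq
    have h₁ : ∀ x (_ : Fin N), ∑ n, jsq tie₁ N x n = 1 := fun x i =>
      sum_jsqd .withoutReplacement tie₁ (d := fun N => N) i.pos le_rfl x
    have h₂ : ∀ x (_ : Fin N), ∑ n, jsqd m tie₂ d N x n = 1 := fun x i =>
      sum_jsqd m tie₂ (hd N i.pos).1 (hd N i.pos).2 x
    have hq : ∀ x, ((∑ n, (if r N ≤ poolsBelow x n then jsqd m tie₂ d N x n else 0) : ℝ≥0) : ℝ)
        ≤ Real.exp (-(d N * (r N / N))) := by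
      intro x
      obtain rfl | hN := Nat.eq_zero_or_pos N
      · simp
      · exact sum_jsqd_poolsBelow_le m tie₂ (hd N hN).2 x (r N)
    have := hξ.coupling (hx₀.quasiMeasurePreserving.ae (hμB N)) h₁ h₂
      (fun x n h j => le_of_jsq_ne_zero h j) hq
    rwa [show P.map (fun ω => (ω 0 N).1) = μ N from hx₀.map_eq] at this
  choose X Y h using key
  exact ⟨_, inferInstance, P, inferInstance, X, Y, h⟩

lemma alike_of_tendsto (hμ : ∀ N, IsProbabilityMeasure (μ N))
    (hμB : ∀ N, ∀ᵐ x ∂(μ N), ∀ n, (x n : ℕ∞) ≤ B) (hd : ∀ N, 1 ≤ N → 1 ≤ d N ∧ d N ≤ N)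
    {g : ℕ → ℝ} (hg : Tendsto g atTop atTop) {r : ℕ → ℕ}
    (hr : Tendsto (fun N => (r N : ℝ) / g N) atTop (𝓝 0))
    (hp : Tendsto (fun N => lam N * Real.exp (-(d N * (r N / N))) / g N) atTop (𝓝 0)) :
    Alike B lam μ g (jsq tie₁) (jsqd m tie₂ d) := by
  obtain ⟨Ω, _, P, hP, X, Y, h⟩ := exists_coupling (lam := lam) (tie₁ := tie₁) (tie₂ := tie₂)
    (m := m) hμ hμB hd r
  refine ⟨Ω, _, P, hP, X, Y, fun N => (h N).1, fun N => (h N).2.1, fun N => (h N).2.2.1,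
    fun T i hi => ?_⟩
  rw [tendstoInMeasure_iff_measureReal_norm]
  intro ε hε
  have hlim : Tendsto (fun N => lam N * Real.exp (-(d N * (r N / N))) / g N * (T / (ε / 4))) atTop
      (𝓝 0) := by simpa using hp.mul_const (T / (ε / 4))
  refine squeeze_zero' (Eventually.of_forall fun _ => measureReal_nonneg) ?_ hlim
  have hir : ∀ᶠ N in atTop, (i : ℝ) * ((r N : ℝ) / g N) < ε / 4 := by
    have := hr.const_mul (i : ℝ)
    rw [mul_zero] at this
    exact this.eventually_lt_const (by positivity)
  filter_upwards [hir, hg.eventually_gt_atTop 0] with N hN hgN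
  -- The pools and the failures contribute at most ε/4 each; the total ε/2 is strictly below ε, as
  -- the event is defined with `≤`.
  obtain ⟨A, hA, hA'⟩ := (h N).2.2.2 T (ε / 4 * g N) (by positivity)
  calc _ ≤ P.real A := by
        rw [measureReal_def, measureReal_def]
        refine ENNReal.toReal_mono (measure_ne_top _ _) (measure_mono_ae ?_)
        filter_upwards [hA'] with ω hω hmem
        by_contra hωA
        have hb : ∀ t : Set.Icc (0 : ℝ≥0) T,
            |(occupancy i (X N t ω) : ℝ) - occupancy i (Y N t ω)| / g N ≤ ε / 2 := by
          intro t
          rw [div_le_iff₀ hgN]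
          refine (hω hωA t t.2.2 i hi).trans ?_
          rw [mul_div_assoc', div_lt_iff₀ hgN] at hN
          linarith
        have : Nonempty (Set.Icc (0 : ℝ≥0) T) := ⟨⟨0, le_rfl, zero_le⟩⟩
        have h0 : (0 : ℝ) ≤ ⨆ t : Set.Icc (0 : ℝ≥0) T,
            |(occupancy i (X N t ω) : ℝ) - occupancy i (Y N t ω)| / g N :=
          Real.iSup_nonneg fun t => by positivity
        have hmem' : ε ≤ ‖(⨆ t : Set.Icc (0 : ℝ≥0) T,
            |(occupancy i (X N t ω) : ℝ) - occupancy i (Y N t ω)| / g N) - 0‖ := hmem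
        rw [sub_zero, Real.norm_of_nonneg h0] at hmem'
        linarith [ciSup_le hb]
    _ ≤ _ := hA
    _ = _ := by field_simp

end Alike

/-! ### The choice of the number of pools -/

section Asymptotics

variable {B : ℕ∞} {lam : ℕ → ℝ≥0} {lamLim : ℝ≥0} {μ : ∀ N, Measure (Config N)}
  {tie₁ tie₂ : ∀ N, TieRule N} {m : Sampling} {d : ℕ → ℕ}

/-- It suffices that the sampled pools hit, in most cases, any set of `ε g(N)` pools, where `ε → 0`
is of the form `1 / √w(N)`. -/
lemma alike_of_tendsto_weight
    (hlam : Tendsto (fun N : ℕ => (lam N : ℝ) / N) atTop (𝓝 (lamLim : ℝ)))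
    (hμ : ∀ N, IsProbabilityMeasure (μ N))
    (hμB : ∀ N, ∀ᵐ x ∂(μ N), ∀ n, (x n : ℕ∞) ≤ B) (hd : ∀ N, 1 ≤ N → 1 ≤ d N ∧ d N ≤ N)
    {g w : ℕ → ℝ} (hg : Tendsto g atTop atTop) (hw : Tendsto w atTop atTop)
    (hp : Tendsto (fun N : ℕ => (N : ℝ) / g N * Real.exp (-(d N * (g N / (√(w N) * N))))) atTop
      (𝓝 0)) :
    Alike B lam μ g (jsq tie₁) (jsqd m tie₂ d) := by
  have hsw : Tendsto (fun N => √(w N)) atTop atTop := Real.tendsto_sqrt_atTop.comp hw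
  -- Rounding up costs 1, so r / g ≤ 1 / √w + 1 / g. In the second condition, lam / g is split as
  -- (lam / N)(N / g), the first factor being convergent.
  refine alike_of_tendsto (r := fun N => ⌈g N / √(w N)⌉₊) hμ hμB hd hg ?_ ?_
  · have h1 : Tendsto (fun N => (√(w N))⁻¹ + (g N)⁻¹) atTop (𝓝 0) := by
      simpa using hsw.inv_tendsto_atTop.add hg.inv_tendsto_atTop
    refine squeeze_zero' ?_ ?_ h1
    · filter_upwards [hg.eventually_gt_atTop 0] with N hN
      positivity
    · filter_upwards [hg.eventually_gt_atTop 0] with N hN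
      rw [div_le_iff₀ hN]
      refine (Nat.ceil_lt_add_one (by positivity)).le.trans (le_of_eq ?_)
      rw [add_mul, inv_mul_cancel₀ hN.ne', div_eq_inv_mul]
  · have h1 := hlam.mul hp
    rw [mul_zero] at h1
    refine squeeze_zero' ?_ ?_ h1
    · filter_upwards [hg.eventually_gt_atTop 0] with N hN
      positivity
    · filter_upwards [hg.eventually_gt_atTop 0, eventually_gt_atTop 0,
        hsw.eventually_gt_atTop 0] with N hN hN0 hs
      have hN0' : (0 : ℝ) < N := by exact_mod_cast hN0
      have e : (lam N : ℝ) / N * (N / g N * Real.exp (-(d N * (g N / (√(w N) * N)))))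
          = lam N * Real.exp (-(d N * (g N / (√(w N) * N)))) / g N := by
        field_simp
      rw [e]
      have hle : g N / (√(w N) * N) ≤ (⌈g N / √(w N)⌉₊ : ℝ) / N := by
        rw [← div_div]
        gcongr
        exact Nat.le_ceil _
      gcongr

/-- Take w = d. If N ≤ C g, the exponent is at least √d / C and the prefactor N / g at most C. -/
lemma alike_of_isTheta
    (hlam : Tendsto (fun N : ℕ => (lam N : ℝ) / N) atTop (𝓝 (lamLim : ℝ)))
    (hμ : ∀ N, IsProbabilityMeasure (μ N))
    (hμB : ∀ N, ∀ᵐ x ∂(μ N), ∀ n, (x n : ℕ∞) ≤ B) (hd : ∀ N, 1 ≤ N → 1 ≤ d N ∧ d N ≤ N)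
    {g : ℕ → ℝ} (hg : Tendsto g atTop atTop) (hgN : g =Θ[atTop] fun N : ℕ => (N : ℝ))
    (hdt : Tendsto d atTop atTop) : Alike B lam μ g (jsq tie₁) (jsqd m tie₂ d) := by
  have hdr : Tendsto (fun N => (d N : ℝ)) atTop atTop := tendsto_natCast_atTop_atTop.comp hdt
  refine alike_of_tendsto_weight hlam hμ hμB hd hg hdr ?_
  obtain ⟨C, hC0, hC⟩ := hgN.2.exists_pos
  rw [IsBigOWith] at hC
  have hlim : Tendsto (fun N => C * Real.exp (-(√(d N) / C))) atTop (𝓝 0) := by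
    have h1 : Tendsto (fun N => √(d N : ℝ) / C) atTop atTop :=
      (Real.tendsto_sqrt_atTop.comp hdr).atTop_div_const hC0
    simpa using (Real.tendsto_exp_neg_atTop_nhds_zero.comp h1).const_mul C
  refine squeeze_zero' ?_ ?_ hlim
  · filter_upwards [hg.eventually_gt_atTop 0] with N hN
    positivity
  · filter_upwards [hg.eventually_gt_atTop 0, hC, hdr.eventually_gt_atTop 0,
      eventually_gt_atTop 0] with N hN hCN hdN hN0
    rw [Real.norm_of_nonneg (Nat.cast_nonneg _), Real.norm_of_nonneg hN.le] at hCN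
    have hN0' : (0 : ℝ) < N := by exact_mod_cast hN0
    have hs : 0 < √(d N : ℝ) := Real.sqrt_pos.2 hdN
    have h1 : (N : ℝ) / g N ≤ C := (div_le_iff₀ hN).2 hCN
    have h2 : √(d N : ℝ) / C ≤ d N * (g N / (√(d N) * N)) := by
      have : (d N : ℝ) * (g N / (√(d N) * N)) = √(d N) * (g N / N) := by
        nth_rw 1 [← Real.mul_self_sqrt hdN.le]
        field_simp
      rw [this, div_eq_mul_inv]
      refine mul_le_mul_of_nonneg_left ?_ hs.le
      rw [inv_le_comm₀ hC0 (by positivity), inv_div]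
      exact h1
    gcongr

lemma alike_of_isLittleO
    (hlam : Tendsto (fun N : ℕ => (lam N : ℝ) / N) atTop (𝓝 (lamLim : ℝ)))
    (hμ : ∀ N, IsProbabilityMeasure (μ N))
    (hμB : ∀ N, ∀ᵐ x ∂(μ N), ∀ n, (x n : ℕ∞) ≤ B) (hd : ∀ N, 1 ≤ N → 1 ≤ d N ∧ d N ≤ N)
    {g : ℕ → ℝ} (hg : Tendsto g atTop atTop) (hgN : g =o[atTop] fun N : ℕ => (N : ℝ))
    (hdt : Tendsto (fun N : ℕ => (d N : ℝ) * ((N : ℝ) / g N * Real.log ((N : ℝ) / g N))⁻¹)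
      atTop atTop) : Alike B lam μ g (jsq tie₁) (jsqd m tie₂ d) := by
  refine alike_of_tendsto_weight hlam hμ hμB hd hg hdt ?_
  have hgN0 : Tendsto (fun N => g N / (N : ℝ)) atTop (𝓝 0) := hgN.tendsto_div_nhds_zero
  refine squeeze_zero' ?_ ?_ hgN0
  · filter_upwards [hg.eventually_gt_atTop 0] with N hN
    positivity
  -- With w equal to the ratio assumed to diverge, the exponent is √w log(N / g). Once w ≥ 4 it is
  -- at least 2 log(N / g), which turns the prefactor N / g into at most g / N.
  · filter_upwards [hg.eventually_gt_atTop 0, hdt.eventually_ge_atTop 4, eventually_gt_atTop 0,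
      hgN0.eventually_lt_const one_pos] with N hN hwN hN0 hgN1
    have hN0' : (0 : ℝ) < N := by exact_mod_cast hN0
    set w := (d N : ℝ) * ((N : ℝ) / g N * Real.log ((N : ℝ) / g N))⁻¹ with hw
    have hq : 0 < (N : ℝ) / g N := by positivity
    have hq1 : 1 < (N : ℝ) / g N := by rwa [one_lt_div hN, ← div_lt_one hN0']
    have hl : 0 < Real.log ((N : ℝ) / g N) := Real.log_pos hq1
    have hs : 2 ≤ √w := Real.le_sqrt_of_sq_le (by linarith)
    have hs0 : 0 < √w := by linarith
    have hdN : (d N : ℝ) = √w * √w * (N / g N * Real.log (N / g N)) := by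
      rw [Real.mul_self_sqrt (by linarith), hw, inv_mul_cancel_right₀ (by positivity)]
    have e : (d N : ℝ) * (g N / (√w * N)) = √w * Real.log (N / g N) := by
      rw [hdN]
      field_simp
    have h2 : 2 * Real.log (N / g N) ≤ √w * Real.log (N / g N) := by gcongr
    calc (N : ℝ) / g N * Real.exp (-(d N * (g N / (√w * N))))
        ≤ N / g N * Real.exp (-(2 * Real.log (N / g N))) := by
          rw [e]
          gcongr
      _ = g N / N := by
          rw [← mul_neg, two_mul, Real.exp_add, Real.exp_neg, Real.exp_log hq]
          field_simp

end Asymptotics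
theorem mainTheorem4 (B : ℕ∞) (lam : ℕ → ℝ≥0) (lamLim : ℝ≥0)
    (hlam : Tendsto (fun N : ℕ => (lam N : ℝ) / N) atTop (𝓝 (lamLim : ℝ)))
    (μ : ∀ N, Measure (Config N)) (hμ : ∀ N, IsProbabilityMeasure (μ N))
    (hμB : ∀ N, ∀ᵐ x ∂(μ N), ∀ n, (x n : ℕ∞) ≤ B)
    (tie₁ tie₂ : ∀ N, TieRule N) (m : Sampling)
    (d : ℕ → ℕ) (hd : ∀ N, 1 ≤ N → 1 ≤ d N ∧ d N ≤ N) :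
    (∀ g : ℕ → ℝ, Tendsto g atTop atTop →
      ((g =Θ[atTop] fun N : ℕ => (N : ℝ)) → Tendsto d atTop atTop →
        Alike B lam μ g (jsq tie₁) (jsqd m tie₂ d)) ∧
      ((g =o[atTop] fun N : ℕ => (N : ℝ)) →
        Tendsto (fun N : ℕ => (d N : ℝ) * ((N : ℝ) / g N * Real.log ((N : ℝ) / g N))⁻¹)
          atTop atTop →
        Alike B lam μ g (jsq tie₁) (jsqd m tie₂ d))) ∧
    (Tendsto d atTop atTop →
      Alike B lam μ (fun N => (N : ℝ)) (jsq tie₁) (jsqd m tie₂ d)) ∧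
    (Tendsto (fun N : ℕ => (d N : ℝ) / (Real.sqrt N * Real.log N)) atTop atTop →
      Alike B lam μ (fun N => Real.sqrt N) (jsq tie₁) (jsqd m tie₂ d)) := by

  have hcast : Tendsto (fun N : ℕ => (N : ℝ)) atTop atTop := tendsto_natCast_atTop_atTop
  refine ⟨fun g hg => ⟨fun hgN hdt => alike_of_isTheta hlam hμ hμB hd hg hgN hdt,
    fun hgN hdt => alike_of_isLittleO hlam hμ hμB hd hg hgN hdt⟩,
    fun hdt => alike_of_isTheta hlam hμ hμB hd hcast (isTheta_refl _ _) hdt, fun hdt => ?_⟩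
  have hsqrt : Tendsto (fun N : ℕ => √(N : ℝ)) atTop atTop := Real.tendsto_sqrt_atTop.comp hcast
  refine alike_of_isLittleO hlam hμ hμB hd hsqrt ?_ ?_
  · refine (isLittleO_iff_tendsto' ?_).2 ?_
    · filter_upwards [eventually_gt_atTop 0] with N hN h
      exact absurd (Nat.cast_eq_zero.1 h) hN.ne'
    · simp only [Real.sqrt_div_self]
      exact hsqrt.inv_tendsto_atTop
  -- For g = √N the ratio N / g is √N, whose logarithm is half of log N; hence the factor 2.
  · refine (hdt.const_mul_atTop two_pos).congr fun N => ?_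
    rw [Real.div_sqrt, Real.log_sqrt (Nat.cast_nonneg N), mul_inv, inv_div]
    rw [div_eq_mul_inv, mul_inv]
    ring
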